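/- Let $W$ be the Coxeter group with generating set $S$ and Coxeter matrix $(m_{s,t})$, where $m_{s,s}=1$ and $m_{s,t}=m_{t,s}\in\{2,3,\dots,\infty\}$ for $s\neq t$. Let $V$ be the real vector space with basis $(\alpha_s)_{s\in S}$ and symmetric bilinear form $\alpha_s\cdot\alpha_t=-\cos(\pi/m_{s,t})$ (equal to $-1$ if $m_{s,t}=\infty$), on which $W$ acts by $s v=v-2(v\cdot\alpha_s)\alpha_s$. A *root* is a vector $w\alpha_s$ with $w\in W$, $s\in S$. Let $C=\{f\in V^*: \langle\alpha_s,f\rangle>0 \text{ for all } s\in S\}$, $\overline{C}=\{f\in V^*: \langle\alpha_s,f\rangle\ge 0 \text{ for all } s\in S\}$, and let $\mathcal{C}=\bigcup_{w\in W}w\overline{C}$ be the Tits cone. A root $\lambda$ is *positive* if $\lambda>0$ on $C$. A positive root $\lambda$ *dominates* a positive root $\mu$ if $\{f\in\mathcal{C}:\langle\mu,f\rangle\ge 0\}\subseteq\{f\in\mathcal{C}:\langle\lambda,f\rangle\ge 0\}$, and $\lambda$ is *minimal* if the only positive root it dominates is $\lambda$ itself. The Coxeter graph has node set $S$ and a link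 of degree $m_{s,t}$ between distinct $s,t$ whenever $m_{s,t}>2$. The *support* of $\lambda=\sum_s\lambda_s\alpha_s$ is $\Theta=\{s:\lambda_s\neq 0\}$; its *boundary* is the set of nodes of $\Theta$ linked to at most one other node of $\Theta$. A minimal root $\lambda$ is *indecomposable* if every $s$ with $\lambda_s=1$ lies in the boundary of its support. **Theorem (no mixed cyclotomy).** Let $\lambda$ be an indecomposable minimal root. Then at most one link of the Coxeter graph with both ends in the support of $\lambda$ has degree $m>3$ (degree $\infty$ included). Consequently the coefficients of $\lambda$ lie in a single ring $\mathbb{Z}[2\cos(\pi/m)]$: there is a finite $m\ge 3$ such that every link in the support of $\lambda$ has degree $3$ or $m$, either $m=3$ or $m$ is the degree of a link in the support of $\lambda$, and $\lambda_s\in\mathbb{Z}[2\cos(\pi/m)]$ for all $s\in S$. (For $m=3$ this ring is $\mathbb{Z}$.) -/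

import Mathlib

namespace CoxeterMatrix

noncomputable section

variable {S : Type*} (M : CoxeterMatrix S)

/-- The standard bilinear form on the real vector space `V = S →₀ ℝ` with basis `(α_s)`:
`α_s · α_t = -cos (π / m_{s,t})`. An infinite `m_{s,t}` is encoded as `M s t = 0`, and then
`-cos (π / 0) = -cos 0 = -1`, as it should be. -/
def stdForm : LinearMap.BilinForm ℝ (S →₀ ℝ) :=
  Finsupp.linearCombination ℝ fun s =>
    Finsupp.linearCombination ℝ fun t => -Real.cos (Real.pi / (M s t : ℝ))

/-- The simple root `α_s`. -/
def simpleRoot (_M : CoxeterMatrix S) (s : S) : S →₀ ℝ := Finsupp.single s 1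

theorem stdForm_simpleRoot (s t : S) :
    M.stdForm (M.simpleRoot s) (M.simpleRoot t) = -Real.cos (Real.pi / (M s t : ℝ)) := by
  simp [stdForm, simpleRoot]

theorem two_stdForm_self (s : S) :
    ((2 : ℝ) • M.stdForm (M.simpleRoot s)) (M.simpleRoot s) = 2 := by
  simp [stdForm_simpleRoot]

/-- The simple reflection `v ↦ v - 2 (α_s · v) α_s`. -/
def simpleRefl (s : S) : (S →₀ ℝ) ≃ₗ[ℝ] (S →₀ ℝ) :=
  Module.reflection (M.two_stdForm_self s)

theorem simpleRefl_apply (s : S) (v : S →₀ ℝ) :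
    M.simpleRefl s v = v - (2 * M.stdForm (M.simpleRoot s) v) • M.simpleRoot s := by
  simp [simpleRefl, Module.reflection_apply]

/-- The simple reflections satisfy the Coxeter relations. -/
theorem simpleRefl_isLiftable : M.IsLiftable M.simpleRefl := by
  intro s t
  by_cases hst : s = t
  · subst hst
    ext1 v
    simp only [diagonal, pow_one, LinearEquiv.mul_apply, LinearEquiv.coe_one, id]
    exact Module.involutive_reflection (M.two_stdForm_self s) v
  have h1 := M.off_diagonal s t hst
  generalize hm : M s t = m at h1
  have hm' : M t s = m := by rw [M.symmetric, hm]
  obtain rfl | hm0 := Nat.eq_zero_or_pos m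
  · simp
  have hx : ((2 : ℝ) • M.stdForm (M.simpleRoot s)) (M.simpleRoot t) *
      ((2 : ℝ) • M.stdForm (M.simpleRoot t)) (M.simpleRoot s) - 2 =
      2 * Real.cos (2 * (Real.pi / m)) := by
    simp only [LinearMap.smul_apply, stdForm_simpleRoot, hm, hm', Real.cos_two_mul, smul_eq_mul]
    ring
  apply LinearEquiv.toLinearMap_injective
  unfold simpleRefl
  rw [Module.reflection_mul_reflection_pow _ _ m _ hx.symm]
  obtain rfl | hm2 := eq_or_ne m 2
  · have hs : M.stdForm (M.simpleRoot s) (M.simpleRoot t) = 0 := by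
      simp [stdForm_simpleRoot, hm]
    have ht : M.stdForm (M.simpleRoot t) (M.simpleRoot s) = 0 := by
      simp [stdForm_simpleRoot, hm']
    have hc : Real.cos (2 * (Real.pi / (2 : ℕ))) = -1 := by
      rw [show 2 * (Real.pi / ((2 : ℕ) : ℝ)) = Real.pi by push_cast; ring, Real.cos_pi]
    rw [hc]
    ext v w
    simp [hs, ht]
    ring
  have hm3 : (3 : ℝ) ≤ m := by exact_mod_cast (by omega : 3 ≤ m)
  set θ : ℝ := 2 * (Real.pi / m) with hθ
  have hmθ : (m : ℝ) * θ = 2 * Real.pi := by rw [hθ]; field_simp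
  have hsin : Real.sin θ ≠ 0 := by
    refine (Real.sin_pos_of_pos_of_lt_pi (by positivity) ?_).ne'
    nlinarith [Real.pi_pos]
  have hS := Polynomial.Chebyshev.S_two_mul_real_cos θ
  obtain ⟨k, hk | hk⟩ := Nat.even_or_odd' m
  · have e1 : ((m : ℤ) - 2) / 2 = k - 1 := by omega
    have e2 : ((m : ℤ) - 1) / 2 = k - 1 := by omega
    have h0 : (Polynomial.Chebyshev.S ℝ ((k : ℤ) - 1)).eval (2 * Real.cos θ) = 0 := by
      have h := hS ((k : ℤ) - 1)
      have h' : (k : ℝ) * θ = Real.pi := by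
        rw [hk] at hmθ; push_cast at hmθ; linarith
      push_cast at h
      rw [sub_add_cancel, h', Real.sin_pi] at h
      exact (mul_eq_zero.mp h).resolve_right hsin
    rw [e1, e2, h0]
    ext v w
    simp
  · have e1 : ((m : ℤ) - 2) / 2 = k - 1 := by omega
    have e2 : ((m : ℤ) - 1) / 2 = k := by omega
    have e3 : ((m : ℤ) - 3) / 2 = k - 1 := by omega
    have e4 : (m : ℤ) / 2 = k := by omega
    have h0 : (Polynomial.Chebyshev.S ℝ (k : ℤ)).eval (2 * Real.cos θ) +
        (Polynomial.Chebyshev.S ℝ ((k : ℤ) - 1)).eval (2 * Real.cos θ) = 0 := by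
      have h := hS ((k : ℤ) - 1)
      have h2 := hS (k : ℤ)
      have h' : ((k : ℝ) + 1) * θ = 2 * Real.pi - (k : ℝ) * θ := by
        rw [hk] at hmθ; push_cast at hmθ; linarith
      push_cast at h h2
      rw [sub_add_cancel] at h
      rw [h', Real.sin_two_pi_sub] at h2
      refine (mul_eq_zero.mp ?_).resolve_right hsin
      rw [add_mul, h, h2]; ring
    rw [e1, e2, e3, e4, h0]
    ext v w
    simp

/-- The standard realization: the representation of the Coxeter group `W = M.Group` on `V` in
which each generator acts by the corresponding simple reflection. -/
def stdRep : M.Group →* ((S →₀ ℝ) ≃ₗ[ℝ] (S →₀ ℝ)) :=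
  M.toCoxeterSystem.lift ⟨M.simpleRefl, M.simpleRefl_isLiftable⟩

theorem stdRep_simple (s : S) : M.stdRep (M.simple s) = M.simpleRefl s :=
  M.toCoxeterSystem.lift_apply_simple M.simpleRefl_isLiftable s

/-- Roots: the transforms `w α_s`. -/
def IsRoot (v : S →₀ ℝ) : Prop :=
  ∃ (w : M.Group) (s : S), v = M.stdRep w (M.simpleRoot s)

/-- The open fundamental chamber `C`, in the dual space of `V`. -/
def chamber : Set (Module.Dual ℝ (S →₀ ℝ)) :=
  {f | ∀ s, 0 < f (M.simpleRoot s)}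

/-- The closed fundamental chamber. -/
def closedChamber : Set (Module.Dual ℝ (S →₀ ℝ)) :=
  {f | ∀ s, 0 ≤ f (M.simpleRoot s)}

/-- The Tits cone: the union of the transforms of the closed chamber under the contragredient
action `(w f)(v) = f (w⁻¹ v)`. -/
def titsCone : Set (Module.Dual ℝ (S →₀ ℝ)) :=
  {f | ∃ w : M.Group, ∃ g ∈ M.closedChamber, ∀ v, f v = g (M.stdRep w⁻¹ v)}

/-- Positive roots: the roots that are positive on the fundamental chamber. -/
def IsPosRoot (v : S →₀ ℝ) : Prop :=
  M.IsRoot v ∧ ∀ f ∈ M.chamber, 0 < f v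

/-- `v` dominates `u`: the half `{v ≥ 0}` of the Tits cone contains the half `{u ≥ 0}`. -/
def Dominates (v u : S →₀ ℝ) : Prop :=
  {f ∈ M.titsCone | 0 ≤ f u} ⊆ {f ∈ M.titsCone | 0 ≤ f v}

/-- Minimal roots: the positive roots that dominate no positive root but themselves. -/
def IsMinimalRoot (v : S →₀ ℝ) : Prop :=
  M.IsPosRoot v ∧ ∀ u, M.IsPosRoot u → M.Dominates v u → u = v

/-- The Coxeter graph: `s` and `t` are linked if `m_{s,t} > 2`, including `m_{s,t} = ∞`, which is
encoded as `0`. -/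
def coxeterGraph : SimpleGraph S where
  Adj s t := s ≠ t ∧ M s t ≠ 2
  symm := ⟨fun s t h => ⟨h.1.symm, by rw [M.symmetric]; exact h.2⟩⟩
  loopless := ⟨fun _ h => h.1 rfl⟩

/-- The boundary of a set `Θ` of nodes of the Coxeter graph: the nodes of `Θ` that are linked to at
most one node of `Θ`. -/
def boundary (Θ : Set S) : Set S :=
  {s ∈ Θ | {t ∈ Θ | M.coxeterGraph.Adj s t}.Subsingleton}

/-- The nodes at which `v` has coefficient `1`. -/
def unitSupport (_M : CoxeterMatrix S) (v : S →₀ ℝ) : Set S := {s | v s = 1}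

/-- Indecomposable minimal roots: the unit support lies in the boundary of the support. -/
def IsIndecomposable (v : S →₀ ℝ) : Prop :=
  M.IsMinimalRoot v ∧ M.unitSupport v ⊆ M.boundary (v.support : Set S)

/-- The links of the Coxeter graph with both ends in `Θ`, as unordered pairs. -/
def linksIn (Θ : Set S) : Set (Sym2 S) :=
  {e ∈ M.coxeterGraph.edgeSet | ∀ s ∈ e, s ∈ Θ}

/-- The degree `m_{s,t}` of a pair `{s, t}` of nodes (`0` stands for `∞`). -/
def degree (e : Sym2 S) : ℕ := Sym2.lift ⟨fun s t => M s t, fun s t => M.symmetric s t⟩ e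

/-- The links in `Θ` of degree greater than `3`, including those of infinite degree. -/
def multipleLinksIn (Θ : Set S) : Set (Sym2 S) :=
  {e ∈ M.linksIn Θ | 3 < M.degree e ∨ M.degree e = 0}

end

end CoxeterMatrix

/-! A minimal root grows from a simple root by simple reflections through minimal roots, each with
`-1 < α_s · u < 0` (`IsMinimalRoot.induction`). Writing `L` for the weighted sum of the coefficients
at the neighbours of `s`, one step replaces `u s` by `L - u s`, where `2 u s < L < 2 u s + 2`. Facts
about minimal roots follow by induction along this chain.

The bounds have force because coefficients have gaps. A positive root has coefficients in `{0, 1} ∪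
[√2, ∞)` (`IsPosRoot.coeff_mem_gap`): it is the image of a root of a simply laced Coxeter group,
with integer coefficients, under a map whose weights are products of Chebyshev values in that
semiring. So a new node of the support has just one neighbour in it, and across a multiple link that
neighbour has coefficient `1`. A second gap, `{0, 1} ∪ [2, ∞)`, holds for the contributions to `L`
at a node with coefficient `1` (`IsMinimalRoot.term_mem_gap`).

Together they yield `IsMinimalRoot.exists_unit`: between two multiple links, on a path that does not
turn back, lies a node with coefficient `1`. It has two distinct neighbours in the support, which
indecomposability forbids. As the support is connected, two multiple links would always be joined by
such a path. The coefficients are integral polynomials in the link weights, hence lie in the ring of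
the one multiple link. -/

namespace CoxeterMatrix

noncomputable section

variable {S : Type*} (M : CoxeterMatrix S)

/-! ### Chebyshev values -/

/-- The sequence `0, 1, c, c ^ 2 - 1, …` satisfying `V (n + 2) = c V (n + 1) - V n`. -/
def chebV (c : ℝ) : ℕ → ℝ
  | 0 => 0
  | 1 => 1
  | n + 2 => c * chebV c (n + 1) - chebV c n

theorem chebV_succ_succ (c : ℝ) (n : ℕ) :
    chebV c (n + 2) = c * chebV c (n + 1) - chebV c n := rfl

theorem chebV_two_mul_cos_mul_sin (θ : ℝ) (n : ℕ) :
    chebV (2 * Real.cos θ) n * Real.sin θ = Real.sin (n * θ) := by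
  induction n using Nat.twoStepInduction with
  | zero => simp [chebV]
  | one => simp [chebV]
  | more n h0 h1 =>
    rw [chebV_succ_succ, sub_mul, mul_assoc, h0, h1]
    have e1 : ((n + 2 : ℕ) : ℝ) * θ = ((n + 1 : ℕ) : ℝ) * θ + θ := by push_cast; ring
    have e2 : (n : ℝ) * θ = ((n + 1 : ℕ) : ℝ) * θ - θ := by push_cast; ring
    rw [e1, e2, Real.sin_add, Real.sin_sub]
    ring

theorem chebV_mono {c : ℝ} (hc : 2 ≤ c) (n : ℕ) :
    0 ≤ chebV c n ∧ chebV c n + 1 ≤ chebV c (n + 1) := by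
  induction n with
  | zero => simp [chebV]
  | succ n ih =>
    refine ⟨by linarith, ?_⟩
    rw [chebV_succ_succ]
    nlinarith

theorem chebV_two (n : ℕ) : chebV 2 n = n := by
  induction n using Nat.twoStepInduction with
  | zero => simp [chebV]
  | one => simp [chebV]
  | more n h0 h1 => rw [chebV_succ_succ, h0, h1]; push_cast; ring

theorem sin_pi_div_pos {m : ℕ} (hm : 2 ≤ m) : 0 < Real.sin (Real.pi / m) := by
  have h2 : (2 : ℝ) ≤ m := by exact_mod_cast hm
  refine Real.sin_pos_of_pos_of_lt_pi (by positivity) ?_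
  rw [div_lt_iff₀ (by linarith)]
  nlinarith [Real.pi_pos]

theorem chebV_cos_nonneg {m n : ℕ} (hm : m ≠ 1) (hn : m = 0 ∨ n ≤ m) :
    0 ≤ chebV (2 * Real.cos (Real.pi / m)) n := by
  obtain rfl | hm0 := Nat.eq_zero_or_pos m
  · simp [chebV_two]
  have hs := sin_pi_div_pos (show 2 ≤ m by omega)
  have h := chebV_two_mul_cos_mul_sin (Real.pi / m) n
  have hnm : (n : ℝ) ≤ m := by exact_mod_cast (by omega : n ≤ m)
  have hm0' : (0 : ℝ) < m := by exact_mod_cast hm0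
  have h' : 0 ≤ Real.sin (n * (Real.pi / m)) := by
    refine Real.sin_nonneg_of_nonneg_of_le_pi (by positivity) ?_
    rw [← mul_div_assoc, div_le_iff₀ hm0']
    nlinarith [Real.pi_pos]
  rw [← h] at h'
  exact nonneg_of_mul_nonneg_left h' hs

/-! ### The form and the action -/

theorem stdForm_eq_sum (v u : S →₀ ℝ) :
    M.stdForm v u = v.sum fun s a => u.sum fun t b =>
      a * (b * -Real.cos (Real.pi / (M s t : ℝ))) := by
  simp [stdForm, Finsupp.linearCombination_apply, Finsupp.sum, LinearMap.sum_apply,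
    Finset.mul_sum]

theorem stdForm_comm (v u : S →₀ ℝ) : M.stdForm v u = M.stdForm u v := by
  rw [stdForm_eq_sum, stdForm_eq_sum, Finsupp.sum_comm]
  simp only [M.symmetric, mul_left_comm]

theorem stdForm_self (s : S) : M.stdForm (M.simpleRoot s) (M.simpleRoot s) = 1 := by
  simp [stdForm_simpleRoot]

theorem simpleRefl_invol (s : S) (v : S →₀ ℝ) : M.simpleRefl s (M.simpleRefl s v) = v :=
  Module.involutive_reflection (M.two_stdForm_self s) v

theorem simpleRefl_self (s : S) : M.simpleRefl s (M.simpleRoot s) = -M.simpleRoot s := by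
  rw [simpleRefl_apply, stdForm_self, mul_one, two_smul]; abel

theorem stdForm_simpleRefl (s : S) (v u : S →₀ ℝ) :
    M.stdForm (M.simpleRefl s v) (M.simpleRefl s u) = M.stdForm v u := by
  simp only [simpleRefl_apply, map_sub, map_smul, LinearMap.sub_apply, LinearMap.smul_apply,
    smul_eq_mul, stdForm_self, M.stdForm_comm v (M.simpleRoot s)]
  ring

theorem stdForm_stdRep (w : M.Group) (v u : S →₀ ℝ) :
    M.stdForm (M.stdRep w v) (M.stdRep w u) = M.stdForm v u := by
  induction w using M.toCoxeterSystem.simple_induction_left with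
  | one => simp
  | mul_simple_left w i ih =>
    rw [map_mul, toCoxeterSystem_simple, stdRep_simple]
    simpa [LinearEquiv.mul_apply, stdForm_simpleRefl] using ih

theorem stdRep_simple_mul (s : S) (w : M.Group) (v : S →₀ ℝ) :
    M.stdRep (M.simple s * w) v = M.simpleRefl s (M.stdRep w v) := by
  rw [map_mul, stdRep_simple]; rfl

theorem stdRep_mul_simple (s : S) (w : M.Group) (v : S →₀ ℝ) :
    M.stdRep (w * M.simple s) v = M.stdRep w (M.simpleRefl s v) := by
  rw [map_mul, stdRep_simple]; rfl

theorem stdRep_inv_apply (w : M.Group) (v : S →₀ ℝ) :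
    M.stdRep w⁻¹ (M.stdRep w v) = v := by
  rw [← LinearEquiv.mul_apply, ← map_mul]; simp

theorem stdRep_apply_inv (w : M.Group) (v : S →₀ ℝ) :
    M.stdRep w (M.stdRep w⁻¹ v) = v := by
  rw [← LinearEquiv.mul_apply, ← map_mul]; simp

/-! ### Positivity of roots -/

open CoxeterSystem

/-- Reduces the positivity of roots to rank two: the signs in a dihedral orbit are the signs of
Chebyshev values. -/
theorem stdRep_alternatingWord (a b : S) (k : ℕ) :
    M.stdRep (M.toCoxeterSystem.wordProd (alternatingWord a b k)) (M.simpleRoot a) =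
      chebV (2 * Real.cos (Real.pi / M a b)) (k + 1) •
        M.simpleRoot (if Even k then a else b) +
      chebV (2 * Real.cos (Real.pi / M a b)) k •
        M.simpleRoot (if Even k then b else a) := by
  induction k with
  | zero => simp [alternatingWord, chebV]
  | succ k ih =>
    rw [alternatingWord_succ', wordProd_cons, toCoxeterSystem_simple, stdRep_simple_mul, ih,
      chebV_succ_succ]
    by_cases hk : Even k
    · simp only [hk, Nat.even_add_one, if_true, not_true_eq_false, if_false, simpleRefl_apply,
        map_add, map_smul, stdForm_self, stdForm_simpleRoot _ b a, M.symmetric b a]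
      module
    · simp only [hk, Nat.even_add_one, if_true, not_false_eq_true, if_false, simpleRefl_apply,
        map_add, map_smul, stdForm_self, stdForm_simpleRoot _ a b]
      module

theorem alternatingWord_add (a b : S) (j k : ℕ) :
    ∃ l : List S, l.length = j ∧ alternatingWord a b (j + k) = l ++ alternatingWord a b k := by
  induction j with
  | zero => exact ⟨[], by simp⟩
  | succ j ih =>
    obtain ⟨l, hl, h⟩ := ih
    refine ⟨(if Even (j + k) then b else a) :: l, by simp [hl], ?_⟩
    rw [show j + 1 + k = j + k + 1 by omega, alternatingWord_succ', h]
    rfl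

/-- Split off the longest alternating suffix ending in `t` whose removal is length-additive; what
remains is then reduced on the right with respect to both `s` and `t`. -/
theorem exists_dihedral_factor (w : M.Group) (s t : S)
    (ht : M.toCoxeterSystem.IsRightDescent w t) :
    ∃ (k : ℕ) (v : M.Group), 1 ≤ k ∧
      w = v * M.toCoxeterSystem.wordProd (alternatingWord s t k) ∧
      M.toCoxeterSystem.length w = M.toCoxeterSystem.length v + k ∧
      ¬ M.toCoxeterSystem.IsRightDescent v s ∧ ¬ M.toCoxeterSystem.IsRightDescent v t := by
  classical
  set cs := M.toCoxeterSystem with hcs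
  let P : ℕ → Prop := fun k => ∃ v : M.Group,
    w = v * cs.wordProd (alternatingWord s t k) ∧ cs.length w = cs.length v + k
  have hP1 : P 1 := by
    refine ⟨w * cs.simple t, ?_, ?_⟩
    · simp [alternatingWord]
    · exact ((cs.isRightDescent_iff).1 ht).symm
  have hb : ∀ k, P k → k ≤ cs.length w := fun k ⟨v, _, h⟩ => by omega
  have hk1 : 1 ≤ Nat.findGreatest P (cs.length w) := Nat.le_findGreatest (hb 1 hP1) hP1
  have hPk : P (Nat.findGreatest P (cs.length w)) := Nat.findGreatest_spec (hb 1 hP1) hP1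
  have hmax : ¬ P (Nat.findGreatest P (cs.length w) + 1) := fun h =>
    absurd (Nat.le_findGreatest (hb _ h) h) (by omega)
  generalize Nat.findGreatest P (cs.length w) = k at hk1 hPk hmax
  obtain ⟨v, hw, hl⟩ := hPk
  -- A descent of `v` at the letter that would come next extends the suffix, against maximality.
  have hA : ¬ cs.IsRightDescent v (if Even k then t else s) := by
    intro h
    refine hmax ⟨v * cs.simple (if Even k then t else s), ?_, ?_⟩
    · rw [alternatingWord_succ', wordProd_cons, mul_assoc, simple_mul_simple_cancel_left, hw]
    · have := (cs.isRightDescent_iff).1 h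
      omega
  -- A descent at the first letter of the suffix cancels it, and `w` would be too short.
  have hB : ¬ cs.IsRightDescent v (if Even k then s else t) := by
    intro h
    obtain ⟨j, rfl⟩ : ∃ j, k = j + 1 := ⟨k - 1, by omega⟩
    have e : (if Even (j + 1) then s else t) = if Even j then t else s := by
      by_cases hj : Even j <;> simp [hj, Nat.even_add_one]
    rw [e] at h
    rw [alternatingWord_succ', wordProd_cons, ← mul_assoc] at hw
    have h1 := cs.length_mul_le (v * cs.simple (if Even j then t else s))
      (cs.wordProd (alternatingWord s t j))
    have h2 := cs.length_wordProd_le (alternatingWord s t j)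
    rw [length_alternatingWord] at h2
    rw [← hw] at h1
    have := (cs.isRightDescent_iff).1 h
    omega
  refine ⟨k, v, hk1, hw, hl, ?_⟩
  by_cases hk : Even k
  · simp only [hk, if_true] at hA hB; exact ⟨hB, hA⟩
  · simp only [hk, if_false] at hA hB; exact ⟨hA, hB⟩

/-- If `ℓ (w s) > ℓ w` then `w α_s` has nonnegative coefficients. -/
theorem stdRep_simpleRoot_nonneg (w : M.Group) (s : S)
    (hs : ¬ M.toCoxeterSystem.IsRightDescent w s) (x : S) :
    0 ≤ M.stdRep w (M.simpleRoot s) x := by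
  induction hn : M.toCoxeterSystem.length w using Nat.strong_induction_on generalizing w s with
  | _ n ih =>
  by_cases hw1 : w = 1
  · subst hw1
    simp only [map_one, LinearEquiv.coe_one, id, simpleRoot]
    exact (Finsupp.single_nonneg.2 zero_le_one : (0 : S →₀ ℝ) ≤ Finsupp.single s 1) x
  obtain ⟨t, ht⟩ := M.toCoxeterSystem.exists_rightDescent_of_ne_one hw1
  have hst : s ≠ t := by rintro rfl; exact hs ht
  obtain ⟨k, v, hk, hw, hl, hvs, hvt⟩ := M.exists_dihedral_factor w s t ht
  -- If `k ≥ m`, the braid relation rewrites the last `m` letters to end in `s`, so `w s` would be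
  -- shorter than `w`. The bound `k + 1 ≤ m` is what makes both Chebyshev values below nonnegative.
  have hkm : M s t = 0 ∨ k + 1 ≤ M s t := by
    by_contra! hcon
    obtain ⟨hm0, hmk⟩ := hcon
    obtain ⟨l, hlen, hword⟩ := alternatingWord_add s t (k - M s t) (M s t)
    rw [Nat.sub_add_cancel (by omega)] at hword
    have hbraid : M.toCoxeterSystem.wordProd (alternatingWord s t (M s t)) =
        M.toCoxeterSystem.wordProd (alternatingWord s t (M s t - 1)) *
          M.toCoxeterSystem.simple s := by
      have h := M.toCoxeterSystem.wordProd_braidWord_eq s t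
      rw [braidWord, braidWord, M.symmetric t s] at h
      rw [h]
      obtain ⟨j, hj⟩ : ∃ j, M s t = j + 1 := ⟨M s t - 1, by omega⟩
      rw [hj, alternatingWord_succ, wordProd_concat]
      rfl
    rw [hword, wordProd_append, hbraid] at hw
    have hws : w * M.toCoxeterSystem.simple s = v * (M.toCoxeterSystem.wordProd
        (l ++ alternatingWord s t (M s t - 1))) := by
      rw [hw, wordProd_append]
      simp only [mul_assoc, simple_mul_simple_self, mul_one]
    have h1 := M.toCoxeterSystem.length_mul_le v (M.toCoxeterSystem.wordProd
        (l ++ alternatingWord s t (M s t - 1)))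
    have h2 := M.toCoxeterSystem.length_wordProd_le (l ++ alternatingWord s t (M s t - 1))
    rw [List.length_append, length_alternatingWord] at h2
    rw [← hws] at h1
    have h3 := (M.toCoxeterSystem.not_isRightDescent_iff).1 hs
    omega
  have hvs' := ih (M.toCoxeterSystem.length v) (by omega) v s hvs rfl
  have hvt' := ih (M.toCoxeterSystem.length v) (by omega) v t hvt rfl
  have hm1 := M.off_diagonal s t hst
  have hV1 := chebV_cos_nonneg (n := k + 1) hm1 hkm
  have hV0 := chebV_cos_nonneg (n := k) hm1 (by omega)
  rw [hw, map_mul, LinearEquiv.mul_apply, stdRep_alternatingWord, map_add, map_smul, map_smul,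
    Finsupp.add_apply, Finsupp.smul_apply, Finsupp.smul_apply, smul_eq_mul, smul_eq_mul]
  split_ifs <;> positivity

/-! ### Roots -/

variable {M}

theorem isRoot_simpleRoot (s : S) : M.IsRoot (M.simpleRoot s) := ⟨1, s, by simp⟩

theorem IsRoot.stdRep {v : S →₀ ℝ} (h : M.IsRoot v) (w : M.Group) : M.IsRoot (M.stdRep w v) := by
  obtain ⟨w', s, rfl⟩ := h
  exact ⟨w * w', s, by rw [map_mul]; rfl⟩

theorem IsRoot.simpleRefl {v : S →₀ ℝ} (h : M.IsRoot v) (s : S) : M.IsRoot (M.simpleRefl s v) := by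
  rw [← stdRep_simple]; exact h.stdRep _

theorem IsRoot.neg {v : S →₀ ℝ} (h : M.IsRoot v) : M.IsRoot (-v) := by
  obtain ⟨w, s, rfl⟩ := h
  exact ⟨w * M.simple s, s, by rw [stdRep_mul_simple, simpleRefl_self, map_neg]⟩

theorem IsRoot.stdForm_self {v : S →₀ ℝ} (h : M.IsRoot v) : M.stdForm v v = 1 := by
  obtain ⟨w, s, rfl⟩ := h
  rw [stdForm_stdRep, CoxeterMatrix.stdForm_self]

theorem IsRoot.ne_zero {v : S →₀ ℝ} (h : M.IsRoot v) : v ≠ 0 := by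
  rintro rfl
  simpa using h.stdForm_self

theorem IsRoot.nonneg_or_nonpos {v : S →₀ ℝ} (h : M.IsRoot v) :
    (∀ x, 0 ≤ v x) ∨ ∀ x, v x ≤ 0 := by
  obtain ⟨w, s, rfl⟩ := h
  by_cases hs : M.toCoxeterSystem.IsRightDescent w s
  · right
    intro x
    have h' := (M.toCoxeterSystem.isRightDescent_iff_not_isRightDescent_mul).1 hs
    have := M.stdRep_simpleRoot_nonneg _ s h' x
    rw [toCoxeterSystem_simple, stdRep_mul_simple, simpleRefl_self, map_neg,
      Finsupp.neg_apply] at this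
    linarith
  · exact Or.inl (M.stdRep_simpleRoot_nonneg w s hs)

/-- The reflection in a root permutes the roots. -/
theorem IsRoot.reflect {v u : S →₀ ℝ} (hv : M.IsRoot v) (hu : M.IsRoot u) :
    M.IsRoot (u - (2 * M.stdForm v u) • v) := by
  obtain ⟨w, s, rfl⟩ := hv
  have h := ((hu.stdRep w⁻¹).simpleRefl s).stdRep w
  rw [simpleRefl_apply, map_sub, map_smul, stdRep_apply_inv] at h
  rwa [← M.stdForm_stdRep w⁻¹ _ u, stdRep_inv_apply]

theorem IsRoot.dihedral {a b : S →₀ ℝ} (ha : M.IsRoot a) (hb : M.IsRoot b) (n : ℕ) :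
    M.IsRoot (chebV (-(2 * M.stdForm a b)) (n + 1) • a + chebV (-(2 * M.stdForm a b)) n • b) ∧
    M.IsRoot (chebV (-(2 * M.stdForm a b)) n • a + chebV (-(2 * M.stdForm a b)) (n + 1) • b) := by
  induction n with
  | zero => simpa [chebV] using ⟨ha, hb⟩
  | succ n ih =>
    have h1 := hb.reflect ih.1
    have h2 := ha.reflect ih.2
    simp only [map_add, map_smul, smul_eq_mul, ha.stdForm_self, hb.stdForm_self,
      M.stdForm_comm b a] at h1 h2
    constructor
    · convert h2 using 1
      rw [chebV_succ_succ]; module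
    · convert h1 using 1
      rw [chebV_succ_succ]; module

theorem exists_chamber_pos : ∃ f ∈ M.chamber, ∀ v : S →₀ ℝ, f v = v.sum fun _ a => a := by
  refine ⟨Finsupp.linearCombination ℝ fun _ => (1 : ℝ), fun s => ?_, fun v => ?_⟩
  · simp [simpleRoot]
  · simp [Finsupp.linearCombination_apply]

theorem eq_sum_simpleRoot (v : S →₀ ℝ) : v = v.sum fun s a => a • M.simpleRoot s := by
  simp [simpleRoot]

theorem dual_apply (f : Module.Dual ℝ (S →₀ ℝ)) (v : S →₀ ℝ) :
    f v = v.sum fun s a => a * f (M.simpleRoot s) := by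
  conv_lhs => rw [eq_sum_simpleRoot (M := M) v]
  simp [Finsupp.sum]

theorem IsPosRoot.nonneg {v : S →₀ ℝ} (h : M.IsPosRoot v) (x : S) : 0 ≤ v x := by
  obtain h1 | h1 := h.1.nonneg_or_nonpos
  · exact h1 x
  · obtain ⟨f, hf, hfv⟩ := exists_chamber_pos (M := M)
    have := h.2 f hf
    rw [hfv] at this
    exact absurd this (not_lt.2 (Finset.sum_nonpos fun i _ => h1 i))

theorem IsRoot.isPosRoot_of_nonneg {v : S →₀ ℝ} (h : M.IsRoot v) (h' : ∀ x, 0 ≤ v x) :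
    M.IsPosRoot v := by
  refine ⟨h, fun f hf => ?_⟩
  rw [dual_apply (M := M)]
  refine Finset.sum_pos (fun i hi => mul_pos ?_ (hf i)) (Finsupp.support_nonempty_iff.2 h.ne_zero)
  exact lt_of_le_of_ne (h' i) (Finsupp.mem_support_iff.1 hi).symm

theorem IsRoot.isPosRoot_of_pos {v : S →₀ ℝ} (h : M.IsRoot v) {x : S} (hx : 0 < v x) :
    M.IsPosRoot v := by
  refine h.isPosRoot_of_nonneg (h.nonneg_or_nonpos.resolve_right fun h' => ?_)
  exact absurd (h' x) (not_le.2 hx)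

theorem isPosRoot_simpleRoot (s : S) : M.IsPosRoot (M.simpleRoot s) :=
  (isRoot_simpleRoot s).isPosRoot_of_pos (x := s) (by simp [simpleRoot])

theorem IsPosRoot.exists_ne_pos {v : S →₀ ℝ} (h : M.IsPosRoot v) {s : S}
    (hs : v ≠ M.simpleRoot s) : ∃ x, x ≠ s ∧ 0 < v x := by
  by_contra! hcon
  have hv : v = v s • M.simpleRoot s := by
    ext x
    by_cases hx : x = s
    · subst hx; simp [simpleRoot]
    · rw [le_antisymm (hcon x hx) (h.nonneg x)]
      simp [simpleRoot, Ne.symm hx]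
  have h1 := h.1.stdForm_self
  rw [hv] at h1
  simp only [map_smul, LinearMap.smul_apply, smul_eq_mul, CoxeterMatrix.stdForm_self, mul_one] at h1
  have h2 := h.nonneg s
  have h3 : v s = 1 := by nlinarith
  rw [h3, one_smul] at hv
  exact hs hv

theorem simpleRefl_apply_of_ne {s x : S} (hx : x ≠ s) (v : S →₀ ℝ) :
    M.simpleRefl s v x = v x := by
  simp [simpleRefl_apply, simpleRoot, Ne.symm hx]

theorem simpleRefl_apply_same (s : S) (v : S →₀ ℝ) :
    M.simpleRefl s v s = v s - 2 * M.stdForm (M.simpleRoot s) v := by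
  simp [simpleRefl_apply, simpleRoot]

theorem IsPosRoot.simpleRefl {v : S →₀ ℝ} (h : M.IsPosRoot v) {s : S}
    (hs : v ≠ M.simpleRoot s) : M.IsPosRoot (M.simpleRefl s v) := by
  obtain ⟨x, hx, hvx⟩ := h.exists_ne_pos hs
  exact (h.1.simpleRefl s).isPosRoot_of_pos (x := x) (by rwa [simpleRefl_apply_of_ne hx])

end

end CoxeterMatrix

namespace CoxeterMatrix

noncomputable section

variable {S : Type*} {M : CoxeterMatrix S}

/-! ### Dominance and minimal roots -/

theorem IsPosRoot.not_neg {v : S →₀ ℝ} (h : M.IsPosRoot v) : ¬ M.IsPosRoot (-v) := by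
  intro h'
  refine h.1.ne_zero (Finsupp.ext fun x => le_antisymm ?_ (h.nonneg x))
  simpa using h'.nonneg x

/-- A simple reflection makes only one positive root negative, so each letter of `w` adds at most
one inversion. -/
theorem finite_inversions (w : M.Group) :
    {v | M.IsPosRoot v ∧ ¬ M.IsPosRoot (M.stdRep w v)}.Finite := by
  induction w using M.toCoxeterSystem.simple_induction_right with
  | one => simp
  | mul_simple_right w s ih =>
    refine ((ih.image (M.simpleRefl s)).insert (M.simpleRoot s)).subset ?_
    rintro v ⟨hv, hwv⟩
    rw [toCoxeterSystem_simple, stdRep_mul_simple] at hwv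
    by_cases hvs : v = M.simpleRoot s
    · exact Or.inl hvs
    · exact Or.inr ⟨M.simpleRefl s v, ⟨hv.simpleRefl hvs, hwv⟩, M.simpleRefl_invol s v⟩

theorem comp_stdRep_mem_titsCone {f : Module.Dual ℝ (S →₀ ℝ)} (hf : f ∈ M.titsCone)
    (w : M.Group) : f.comp (M.stdRep w).toLinearMap ∈ M.titsCone := by
  obtain ⟨w', g, hg, h⟩ := hf
  refine ⟨w⁻¹ * w', g, hg, fun v => ?_⟩
  simp only [LinearMap.comp_apply, LinearEquiv.coe_coe, h]
  rw [mul_inv_rev, inv_inv, map_mul, LinearEquiv.mul_apply]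

theorem Dominates.stdRep {v u : S →₀ ℝ} (h : M.Dominates v u) (w : M.Group) :
    M.Dominates (M.stdRep w v) (M.stdRep w u) := fun _ ⟨hf, hfu⟩ =>
  ⟨hf, (h ⟨comp_stdRep_mem_titsCone hf w, hfu⟩).2⟩

theorem Dominates.simpleRefl {v u : S →₀ ℝ} (h : M.Dominates v u) (s : S) :
    M.Dominates (M.simpleRefl s v) (M.simpleRefl s u) := by
  rw [← stdRep_simple]; exact h.stdRep _

theorem closedChamber_nonneg {g : Module.Dual ℝ (S →₀ ℝ)} (hg : g ∈ M.closedChamber)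
    {v : S →₀ ℝ} (hv : ∀ x, 0 ≤ v x) : 0 ≤ g v := by
  rw [dual_apply (M := M)]
  exact Finset.sum_nonneg fun i _ => mul_nonneg (hv i) (hg i)

/-- When the form is at least `1`, `v` and `-α_s` generate an infinite family of positive roots. A
point of the Tits cone violating dominance would be negative on all of them, but it can be negative
on only finitely many positive roots. -/
theorem IsPosRoot.dominates_simpleRoot {v : S →₀ ℝ} (hv : M.IsPosRoot v) {s : S}
    (hvs : v ≠ M.simpleRoot s) (h1 : 1 ≤ M.stdForm (M.simpleRoot s) v) :
    M.Dominates v (M.simpleRoot s) := by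
  rintro f ⟨hf, hfs⟩
  refine ⟨hf, ?_⟩
  by_contra! hfv
  obtain ⟨w, g, hg, hfg⟩ := hf
  obtain ⟨x, hxs, hx⟩ := hv.exists_ne_pos hvs
  have hc : -(2 * M.stdForm v (-M.simpleRoot s)) = 2 * M.stdForm (M.simpleRoot s) v := by
    rw [map_neg, M.stdForm_comm]; ring
  have hd := hv.1.dihedral (isRoot_simpleRoot s).neg
  rw [hc] at hd
  set c := 2 * M.stdForm (M.simpleRoot s) v with hcdef
  have hV := chebV_mono (show 2 ≤ c by linarith)
  -- Distinctness and positivity are read off at a node `x ≠ s`, where only `v` contributes.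
  let β : ℕ → (S →₀ ℝ) := fun n => chebV c (n + 1) • v + chebV c n • (-M.simpleRoot s)
  have hβx : ∀ n, β n x = chebV c (n + 1) * v x := by
    intro n; simp [β, simpleRoot, Ne.symm hxs]
  have hinj : Function.Injective β := by
    have hmono : StrictMono fun n => chebV c (n + 1) :=
      strictMono_nat_of_lt_succ fun n => by linarith [(hV (n + 1)).2]
    intro m n hmn
    apply hmono.injective
    have := DFunLike.congr_fun hmn x
    rw [hβx, hβx] at this
    exact mul_right_cancel₀ hx.ne' this
  refine Set.infinite_of_injective_forall_mem hinj (fun n => ?_) (finite_inversions w⁻¹)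
  have hpos : 0 < chebV c (n + 1) := by linarith [(hV n).1, (hV n).2]
  refine ⟨(hd n).1.isPosRoot_of_pos (x := x) ?_, fun hcon => ?_⟩
  · change 0 < β n x
    rw [hβx]; positivity
  · have h := closedChamber_nonneg hg hcon.nonneg
    rw [← hfg] at h
    simp only [β, map_add, map_smul, map_neg, smul_eq_mul] at h
    nlinarith [(hV n).1, mul_nonneg (hV n).1 hfs, mul_pos hpos (neg_pos.2 hfv)]

theorem IsMinimalRoot.stdForm_lt_one {v : S →₀ ℝ} (hv : M.IsMinimalRoot v) {s : S}
    (hvs : v ≠ M.simpleRoot s) : M.stdForm (M.simpleRoot s) v < 1 := by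
  by_contra! h
  exact hvs (hv.2 _ (isPosRoot_simpleRoot s) (hv.1.dominates_simpleRoot hvs h)).symm

theorem IsRoot.exists_titsCone_neg {v : S →₀ ℝ} (hv : M.IsRoot v) :
    ∃ f ∈ M.titsCone, f v < 0 := by
  obtain ⟨w, t, rfl⟩ := hv
  obtain ⟨g, hg, -⟩ := exists_chamber_pos (M := M)
  refine ⟨g.comp (M.stdRep (M.simple t * w⁻¹)).toLinearMap,
    ⟨w * M.simple t, g, fun s => (hg s).le, fun v => ?_⟩, ?_⟩
  · have : (M.simple t)⁻¹ = M.simple t := M.toCoxeterSystem.inv_simple t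
    rw [mul_inv_rev, this]; rfl
  · simp only [LinearMap.comp_apply, LinearEquiv.coe_coe]
    rw [stdRep_simple_mul, stdRep_inv_apply, simpleRefl_self, map_neg]
    exact neg_neg_of_pos (hg t)

theorem IsMinimalRoot.simpleRefl {v : S →₀ ℝ} (hv : M.IsMinimalRoot v) {s : S}
    (hvs : v ≠ M.simpleRoot s) (hpos : 0 < M.stdForm (M.simpleRoot s) v) :
    M.IsMinimalRoot (M.simpleRefl s v) := by
  refine ⟨hv.1.simpleRefl hvs, fun u hu hd => ?_⟩
  by_cases hus : u = M.simpleRoot s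
  · subst hus
    exfalso
    obtain ⟨f, hf, hfv⟩ := hv.1.1.exists_titsCone_neg
    refine absurd hfv (not_lt.2 ?_)
    obtain h | h := le_total 0 (f (M.simpleRoot s))
    · have h1 : 0 ≤ f (M.simpleRefl s v) := (hd ⟨hf, h⟩).2
      rw [simpleRefl_apply, map_sub, map_smul, smul_eq_mul] at h1
      nlinarith [mul_nonneg hpos.le h]
    · have hf' := comp_stdRep_mem_titsCone hf (M.simple s)
      rw [stdRep_simple] at hf'
      have h1 := (hd ⟨hf', by simpa [simpleRefl_self] using h⟩).2
      simpa [simpleRefl_invol] using h1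
  · have hd' := hd.simpleRefl s
    rw [simpleRefl_invol] at hd'
    rw [← hv.2 _ (hu.simpleRefl hus) hd', simpleRefl_invol]

/-- Every minimal root is reached from a simple root by simple reflections that pass through
minimal roots only, each raising one coefficient. -/
theorem IsMinimalRoot.induction {P : (S →₀ ℝ) → Prop} (simple : ∀ s, P (M.simpleRoot s))
    (step : ∀ u s, M.IsMinimalRoot u → M.IsMinimalRoot (M.simpleRefl s u) →
      -1 < M.stdForm (M.simpleRoot s) u → M.stdForm (M.simpleRoot s) u < 0 → P u →
      P (M.simpleRefl s u))
    {v : S →₀ ℝ} (hv : M.IsMinimalRoot v) : P v := by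
  have key : ∀ n (w : M.Group), M.toCoxeterSystem.length w = n → ∀ v, M.IsMinimalRoot v →
      ¬ M.IsPosRoot (M.stdRep w v) → P v := by
    intro n
    induction n with
    | zero =>
      intro w hw v hv hwv
      rw [M.toCoxeterSystem.length_eq_zero_iff] at hw
      subst hw
      exact absurd hv.1 (by simpa using hwv)
    | succ n ih =>
      intro w hw v hv hwv
      have hw1 : w ≠ 1 := by
        rintro rfl
        simp at hw
      obtain ⟨s, hs⟩ := M.toCoxeterSystem.exists_rightDescent_of_ne_one hw1
      have hs' := (M.toCoxeterSystem.isRightDescent_iff).1 hs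
      have hn := (M.toCoxeterSystem.isRightDescent_iff_not_isRightDescent_mul).1 hs
      obtain ⟨w', rfl⟩ : ∃ w', w = w' * M.toCoxeterSystem.simple s :=
        ⟨w * M.toCoxeterSystem.simple s, by
          simp only [CoxeterSystem.simple_mul_simple_cancel_right]⟩
      rw [CoxeterSystem.simple_mul_simple_cancel_right] at hn hs'
      by_cases hw'v : M.IsPosRoot (M.stdRep w' v)
      swap
      · exact ih w' (by omega) v hv hw'v
      by_cases hvs : v = M.simpleRoot s
      · rw [hvs]; exact simple s
      rw [toCoxeterSystem_simple, stdRep_mul_simple] at hwv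
      -- Otherwise `w' (s v)` is `w' v` plus a nonnegative multiple of `w' α_s ≥ 0`, hence positive,
      -- although `w` makes `v` nonpositive.
      have hpos : 0 < M.stdForm (M.simpleRoot s) v := by
        by_contra! hle
        refine hwv (((hv.1.1.simpleRefl s).stdRep w').isPosRoot_of_nonneg fun x => ?_)
        have h1 := M.stdRep_simpleRoot_nonneg w' s hn x
        have h2 := hw'v.nonneg x
        rw [simpleRefl_apply, map_sub, map_smul, Finsupp.sub_apply, Finsupp.smul_apply, smul_eq_mul]
        nlinarith
      have hmin := hv.simpleRefl hvs hpos
      have hlt := hv.stdForm_lt_one hvs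
      have hform : M.stdForm (M.simpleRoot s) (M.simpleRefl s v) =
          -M.stdForm (M.simpleRoot s) v := by
        rw [simpleRefl_apply, map_sub, map_smul, stdForm_self, smul_eq_mul]; ring
      have := step (M.simpleRefl s v) s hmin (by rwa [simpleRefl_invol]) (by rw [hform]; linarith)
        (by rw [hform]; linarith) (ih w' (by omega) _ hmin hwv)
      rwa [simpleRefl_invol] at this
  obtain ⟨w, t, hwt⟩ := hv.1.1
  -- This element carries `v = w α_t` to `-α_t`.
  refine key _ (M.simple t * w⁻¹) rfl v hv ?_
  rw [hwt, stdRep_simple_mul, stdRep_inv_apply, simpleRefl_self]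
  exact (isPosRoot_simpleRoot t).not_neg

end

end CoxeterMatrix

namespace CoxeterMatrix

noncomputable section

variable {S : Type*} (M : CoxeterMatrix S)

/-! ### A gap in the set of coefficients of roots -/

/-- The semiring `{0, 1} ∪ [r, ∞)`, for `1 ≤ r ≤ 2`. -/
def gapSemiring (r : ℝ) (h1 : 1 ≤ r) (h2 : r ≤ 2) : Subsemiring ℝ where
  carrier := {a | a = 0 ∨ a = 1 ∨ r ≤ a}
  zero_mem' := Or.inl rfl
  one_mem' := Or.inr (Or.inl rfl)
  add_mem' := by
    rintro a b (rfl | rfl | ha) (rfl | rfl | hb)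
    · simp
    · simp
    · simp [hb]
    · simp
    · right; right; linarith
    · right; right; linarith
    · simp [ha]
    · right; right; linarith
    · right; right; linarith
  mul_mem' := by
    rintro a b (rfl | rfl | ha) (rfl | rfl | hb)
    · simp
    · simp
    · simp
    · simp
    · simp
    · simp [hb]
    · simp
    · simp [ha]
    · right; right; nlinarith

theorem gapSemiring_nonneg {r : ℝ} {h1 : 1 ≤ r} {h2 : r ≤ 2} {a : ℝ}
    (h : a ∈ gapSemiring r h1 h2) : 0 ≤ a := by
  rcases h with rfl | rfl | h <;> linarith

theorem one_le_sqrt_two : 1 ≤ √2 := Real.one_le_sqrt.2 one_le_two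

theorem sqrt_two_le_two : √2 ≤ 2 := by
  rw [Real.sqrt_le_left (by norm_num)]; norm_num

theorem sqrt_two_le_two_mul_cos {m : ℕ} (hm : 4 ≤ m ∨ m = 0) :
    √2 ≤ 2 * Real.cos (Real.pi / m) := by
  obtain hm | rfl := hm
  · have hm' : (4 : ℝ) ≤ m := by exact_mod_cast hm
    have h : Real.cos (Real.pi / 4) ≤ Real.cos (Real.pi / m) := by
      refine Real.cos_le_cos_of_nonneg_of_le_pi (by positivity)
        (by linarith [Real.pi_pos]) ?_
      exact div_le_div_of_nonneg_left Real.pi_pos.le (by norm_num) hm'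
    rw [Real.cos_pi_div_four] at h
    linarith
  · simp

/-- With `θ = π / m` the value is `sin ((j + 1) θ) / sin θ`: it is `1` at both ends of the range,
and in between at least its value `2 cos θ` at `j = 1`, because the sine rises and falls
symmetrically on `[0, π]`. -/
theorem chebV_cos_mem_gap {m j : ℕ} (hj : m = 0 ∨ j + 1 < m) :
    chebV (2 * Real.cos (Real.pi / m)) (j + 1) ∈
      gapSemiring √2 one_le_sqrt_two sqrt_two_le_two := by
  obtain rfl | hm0 := Nat.eq_zero_or_pos m
  · simp only [Nat.cast_zero, div_zero, Real.cos_zero, mul_one, chebV_two]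
    exact natCast_mem _ _
  have hjm : j + 1 < m := by omega
  have hs := sin_pi_div_pos (show 2 ≤ m by omega)
  have hV := chebV_two_mul_cos_mul_sin (Real.pi / m) (j + 1)
  have hmpos : (0 : ℝ) < m := by exact_mod_cast hm0
  have hmθ : (m : ℝ) * (Real.pi / m) = Real.pi := by field_simp
  have hθ : 0 < Real.pi / m := by positivity
  obtain rfl | hj0 := Nat.eq_zero_or_pos j
  · exact Or.inr (Or.inl rfl)
  by_cases hj2 : j + 2 = m
  · right; left
    have h2 : ((j + 1 : ℕ) : ℝ) * (Real.pi / m) = Real.pi - Real.pi / m := by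
      have : ((j + 1 : ℕ) : ℝ) = m - 1 := by rw [← hj2]; push_cast; ring
      rw [this, sub_mul, hmθ, one_mul]
    rw [h2, Real.sin_pi_sub] at hV
    exact mul_right_cancel₀ hs.ne' (by rw [hV, one_mul])
  · right; right
    refine (sqrt_two_le_two_mul_cos (m := m) (by omega)).trans ?_
    refine le_of_mul_le_mul_right ?_ hs
    have h2 : 2 * Real.cos (Real.pi / m) * Real.sin (Real.pi / m) =
        Real.sin (2 * (Real.pi / m)) := by rw [Real.sin_two_mul]; ring
    rw [hV, h2, ← sub_nonneg, Real.sin_sub_sin]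
    have hj1 : (1 : ℝ) ≤ j := by exact_mod_cast hj0
    have hj3 : (j : ℝ) + 3 ≤ m := by exact_mod_cast (by omega : j + 3 ≤ m)
    refine mul_nonneg (mul_nonneg two_pos.le (Real.sin_nonneg_of_nonneg_of_le_pi ?_ ?_))
      (Real.cos_nonneg_of_neg_pi_div_two_le_of_le ?_ ?_) <;> push_cast <;> nlinarith

/-! ### The simply laced unfolding -/

/-- `U_j (2 cos (π / m))` for `j + 1 < m` (any `j` if `m = ∞`), and `0` for larger `j`. -/
def truncU (m j : ℕ) : ℝ :=
  -- The case `j = 0` is listed apart for the pairs of degree `1` on the diagonal; the value must be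
  -- `1` there for finitely supported products to make sense.
  if j = 0 ∨ m = 0 ∨ j + 1 < m then chebV (2 * Real.cos (Real.pi / m)) (j + 1) else 0

theorem truncU_zero (m : ℕ) : truncU m 0 = 1 := by simp [truncU, chebV]

theorem truncU_mem_gap (m j : ℕ) :
    truncU m j ∈ gapSemiring √2 one_le_sqrt_two sqrt_two_le_two := by
  unfold truncU
  split_ifs with h
  · obtain rfl | h := h
    · exact Or.inr (Or.inl rfl)
    · exact chebV_cos_mem_gap h
  · exact zero_mem _

/-- One step past the end of the path the truncation changes nothing, since `U_{m-1}` vanishes at `2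
cos (π / m)`. -/
theorem truncU_succ {m j : ℕ} (hj : m = 0 ∨ j + 1 < m) :
    truncU m (j + 1) = chebV (2 * Real.cos (Real.pi / m)) (j + 2) := by
  by_cases h : j + 1 = 0 ∨ m = 0 ∨ j + 1 + 1 < m
  · rw [truncU, if_pos h]
  · rw [truncU, if_neg h]
    have hm : m = j + 2 := by omega
    have hV := chebV_two_mul_cos_mul_sin (Real.pi / m) (j + 2)
    have hs := sin_pi_div_pos (show 2 ≤ m by omega)
    have hm0 : (m : ℝ) ≠ 0 := by rw [hm]; positivity
    rw [← hm, mul_div_cancel₀ _ hm0, Real.sin_pi] at hV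
    rw [← hm]
    exact ((mul_eq_zero.1 hV).resolve_right hs.ne').symm

theorem two_cos_mul_truncU_zero {m : ℕ} (hm : m ≠ 1) :
    2 * Real.cos (Real.pi / m) * truncU m 0 = truncU m 1 := by
  rw [truncU_succ (j := 0) (by omega), truncU_zero]
  simp [chebV]

theorem two_cos_mul_truncU_succ {m j : ℕ} (hj : m = 0 ∨ j + 2 < m) :
    2 * Real.cos (Real.pi / m) * truncU m (j + 1) = truncU m (j + 2) + truncU m j := by
  rw [truncU_succ (j := j + 1) (by omega), truncU_succ (j := j) (by omega),
    chebV_succ_succ _ (j + 1), truncU, if_pos (by omega)]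
  ring

/-- The product over the pairs `e` of nodes of `U_{k e} (2 cos (π / m_e))`. -/
def unfoldCoeff (k : Sym2 S →₀ ℕ) : ℝ := k.prod fun e j => truncU (M.degree e) j

theorem unfoldCoeff_zero : M.unfoldCoeff 0 = 1 := Finsupp.prod_zero_index

theorem unfoldCoeff_mem_gap (k : Sym2 S →₀ ℕ) :
    M.unfoldCoeff k ∈ gapSemiring √2 one_le_sqrt_two sqrt_two_le_two :=
  prod_mem fun _ _ => truncU_mem_gap _ _

theorem unfoldCoeff_eq (k : Sym2 S →₀ ℕ) (e : Sym2 S) :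
    M.unfoldCoeff k = truncU (M.degree e) (k e) * M.unfoldCoeff (k.erase e) :=
  (Finsupp.mul_prod_erase' k e _ fun _ => truncU_zero _).symm

theorem unfoldCoeff_add_single (k : Sym2 S →₀ ℕ) (e : Sym2 S) :
    M.unfoldCoeff (k + Finsupp.single e 1) =
      truncU (M.degree e) (k e + 1) * M.unfoldCoeff (k.erase e) := by
  rw [unfoldCoeff_eq _ _ e, Finsupp.erase_add, Finsupp.erase_single]
  simp

/-- Adjacency in the unfolded Coxeter graph: over a link `e` of degree `m`, the coordinate at `e`
moves along a path with `m - 1` nodes. -/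
def UnfoldAdj (p q : S × (Sym2 S →₀ ℕ)) : Prop :=
  (q.2 = p.2 + Finsupp.single s(p.1, q.1) 1 ∨ p.2 = q.2 + Finsupp.single s(p.1, q.1) 1) ∧
  (M p.1 q.1 = 0 ∨ p.2 s(p.1, q.1) + 1 < M p.1 q.1) ∧
  (M p.1 q.1 = 0 ∨ q.2 s(p.1, q.1) + 1 < M p.1 q.1)

theorem unfoldAdj_comm (p q : S × (Sym2 S →₀ ℕ)) : M.UnfoldAdj p q ↔ M.UnfoldAdj q p := by
  unfold UnfoldAdj
  rw [M.symmetric q.1 p.1, Sym2.eq_swap (a := q.1)]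
  tauto

theorem not_unfoldAdj (s : S) (k l : Sym2 S →₀ ℕ) : ¬ M.UnfoldAdj (s, k) (s, l) := by
  simp [UnfoldAdj]

open Classical in
/-- The simply laced Coxeter matrix that unfolds `M`. -/
def unfolding : CoxeterMatrix (S × (Sym2 S →₀ ℕ)) where
  M := Matrix.of fun p q => if p = q then 1 else if M.UnfoldAdj p q then 3 else 2
  isSymm := by
    ext p q
    simp only [Matrix.transpose_apply, Matrix.of_apply, eq_comm (a := q), M.unfoldAdj_comm q p]
  diagonal := by simp
  off_diagonal := by
    intro p q h
    simp only [Matrix.of_apply, if_neg h]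
    split_ifs <;> omega

open Classical in
theorem unfolding_apply (p q : S × (Sym2 S →₀ ℕ)) :
    M.unfolding p q = if p = q then 1 else if M.UnfoldAdj p q then 3 else 2 := rfl

open Classical in
theorem two_mul_stdForm_unfolding (p q : S × (Sym2 S →₀ ℕ)) :
    2 * M.unfolding.stdForm (M.unfolding.simpleRoot p) (M.unfolding.simpleRoot q) =
      if p = q then 2 else if M.UnfoldAdj p q then -1 else 0 := by
  rw [stdForm_simpleRoot, unfolding_apply]
  split_ifs
  · simp
  · push_cast; rw [Real.cos_pi_div_three]; norm_num
  · push_cast; rw [Real.cos_pi_div_two]; norm_num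

/-- The linear map sending the simple root at `(s, k)` to a multiple of `α_s`. -/
def foldMap : ((S × (Sym2 S →₀ ℕ)) →₀ ℝ) →ₗ[ℝ] (S →₀ ℝ) :=
  Finsupp.linearCombination ℝ fun p => M.unfoldCoeff p.2 • M.simpleRoot p.1

theorem foldMap_simpleRoot (p : S × (Sym2 S →₀ ℕ)) :
    M.foldMap (M.unfolding.simpleRoot p) = M.unfoldCoeff p.2 • M.simpleRoot p.1 := by
  simp [foldMap, simpleRoot]

-- The truncated Chebyshev values form an eigenvector of the path with `m - 1` nodes, with
-- eigenvalue `2 cos (π / m)`. The neighbours of `(t, l)` over `s` are found by moving one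
-- coordinate of `l` up or down; off the path both sides vanish.
open Classical in
theorem sum_unfoldAdj {s t : S} (hst : t ≠ s) (l : Sym2 S →₀ ℕ) (F : Finset (Sym2 S →₀ ℕ))
    (h1 : l + Finsupp.single s(t, s) 1 ∈ F) (h2 : l - Finsupp.single s(t, s) 1 ∈ F) :
    ∑ k ∈ F, (if M.UnfoldAdj (t, l) (s, k) then M.unfoldCoeff k else 0) =
      2 * Real.cos (Real.pi / M t s) * M.unfoldCoeff l := by
  have hm1 := M.off_diagonal t s hst
  have hdeg : M.degree s(t, s) = M t s := rfl
  set e := s(t, s) with he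
  by_cases hl : M t s = 0 ∨ l e + 1 < M t s
  swap
  · rw [M.unfoldCoeff_eq l e, hdeg, truncU, if_neg (by omega), zero_mul, mul_zero]
    refine Finset.sum_eq_zero fun k _ => if_neg fun h => hl h.2.1
  have hsplit : ∀ k ∈ F, (if M.UnfoldAdj (t, l) (s, k) then M.unfoldCoeff k else 0) =
      (if k = l + Finsupp.single e 1 then M.unfoldCoeff k else 0) +
      (if l = k + Finsupp.single e 1 then M.unfoldCoeff k else 0) := by
    intro k _
    by_cases hk1 : k = l + Finsupp.single e 1
    · have hne : l ≠ k + Finsupp.single e 1 := by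
        intro h
        have := DFunLike.congr_fun h e
        rw [hk1] at this
        simp at this
        omega
      rw [if_pos hk1, if_neg hne, add_zero]
      by_cases hr : M t s = 0 ∨ k e + 1 < M t s
      · rw [if_pos ⟨Or.inl hk1, hl, hr⟩]
      · rw [if_neg fun h => hr h.2.2, M.unfoldCoeff_eq k e, hdeg, truncU, if_neg (by omega),
          zero_mul]
    · rw [if_neg hk1, zero_add]
      by_cases hk2 : l = k + Finsupp.single e 1
      · rw [if_pos hk2, if_pos]
        refine ⟨Or.inr hk2, hl, ?_⟩
        have := DFunLike.congr_fun hk2 e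
        simp at this
        change M t s = 0 ∨ k e + 1 < M t s
        omega
      · rw [if_neg hk2, if_neg]
        rintro ⟨h | h, -⟩
        exacts [hk1 h, hk2 h]
  rw [Finset.sum_congr rfl hsplit, Finset.sum_add_distrib, Finset.sum_ite_eq' F, if_pos h1]
  obtain h0 | ⟨j, hj⟩ : l e = 0 ∨ ∃ j, l e = j + 1 := by
    cases h : l e <;> simp
  · rw [Finset.sum_eq_zero, add_zero, unfoldCoeff_add_single, M.unfoldCoeff_eq l e, hdeg, h0,
      ← two_cos_mul_truncU_zero hm1]
    · ring
    · intro k _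
      refine if_neg fun h => ?_
      rw [h] at h0
      simp at h0
  · have hle : Finsupp.single e 1 ≤ l := by
      rw [Finsupp.single_le_iff]; omega
    obtain ⟨l', hl'⟩ : ∃ l', l = l' + Finsupp.single e 1 := ⟨_, (tsub_add_cancel_of_le hle).symm⟩
    have hl'e : l' e = j := by
      rw [hl'] at hj
      simpa using hj
    have herase : l.erase e = l'.erase e := by
      rw [hl', Finsupp.erase_add, Finsupp.erase_single, add_zero]
    have hl'F : l' ∈ F := by
      rwa [hl', add_tsub_cancel_right] at h2
    have hsum : ∑ k ∈ F, (if l = k + Finsupp.single e 1 then M.unfoldCoeff k else 0) =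
        M.unfoldCoeff l' := by
      rw [Finset.sum_eq_single l']
      · rw [if_pos hl']
      · intro k _ hk
        refine if_neg fun h => hk ?_
        rw [hl'] at h
        exact (add_right_cancel h).symm
      · exact fun h => absurd hl'F h
    rw [hsum, unfoldCoeff_add_single, M.unfoldCoeff_eq l e, M.unfoldCoeff_eq l' e, hdeg, herase, hj,
      hl'e, ← mul_assoc, two_cos_mul_truncU_succ (by omega), add_mul]

theorem sum_stdForm_unfolding (s t : S) (l : Sym2 S →₀ ℕ) (F : Finset (Sym2 S →₀ ℕ))
    (h0 : l ∈ F) (h1 : l + Finsupp.single s(t, s) 1 ∈ F) (h2 : l - Finsupp.single s(t, s) 1 ∈ F) :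
    ∑ k ∈ F, 2 * M.unfolding.stdForm (M.unfolding.simpleRoot (s, k))
      (M.unfolding.simpleRoot (t, l)) * M.unfoldCoeff k =
      2 * M.stdForm (M.simpleRoot s) (M.simpleRoot t) * M.unfoldCoeff l := by
  classical
  simp only [two_mul_stdForm_unfolding]
  by_cases hst : t = s
  · subst hst
    rw [stdForm_self, Finset.sum_eq_single l]
    · simp
    · intro k _ hk
      rw [if_neg (by simpa using hk), if_neg (M.not_unfoldAdj t k l), zero_mul]
    · exact fun h => absurd h0 h
  · rw [stdForm_simpleRoot, M.symmetric s t]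
    have h := M.sum_unfoldAdj hst l F h1 h2
    rw [show 2 * -Real.cos (Real.pi / M t s) * M.unfoldCoeff l =
      -(2 * Real.cos (Real.pi / M t s) * M.unfoldCoeff l) by ring, ← h, ← Finset.sum_neg_distrib]
    refine Finset.sum_congr rfl fun k _ => ?_
    rw [if_neg (by simp [Ne.symm hst]), M.unfoldAdj_comm (s, k)]
    split_ifs <;> simp

theorem exists_finset_sum_stdForm (s : S) (v : (S × (Sym2 S →₀ ℕ)) →₀ ℝ) :
    ∃ F : Finset (Sym2 S →₀ ℕ),
      ∑ k ∈ F, 2 * M.unfolding.stdForm (M.unfolding.simpleRoot (s, k)) v * M.unfoldCoeff k =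
      2 * M.stdForm (M.simpleRoot s) (M.foldMap v) := by
  classical
  -- All possible neighbours over `s` of the support of `v`, and the support's own second
  -- coordinates for the diagonal terms.
  let F := v.support.biUnion fun p =>
    {p.2, p.2 + Finsupp.single s(p.1, s) 1, p.2 - Finsupp.single s(p.1, s) 1}
  refine ⟨F, ?_⟩
  have hL : ∀ k, M.unfolding.stdForm (M.unfolding.simpleRoot (s, k)) v =
      v.sum fun p a => a * M.unfolding.stdForm (M.unfolding.simpleRoot (s, k))
        (M.unfolding.simpleRoot p) := fun k => dual_apply _ v
  have hR : M.stdForm (M.simpleRoot s) (M.foldMap v) =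
      v.sum fun p a => a * (M.unfoldCoeff p.2 * M.stdForm (M.simpleRoot s) (M.simpleRoot p.1)) := by
    have := dual_apply (M := M.unfolding) ((M.stdForm (M.simpleRoot s)).comp M.foldMap) v
    simpa [foldMap_simpleRoot] using this
  simp only [hL, hR, Finsupp.sum, Finset.mul_sum, Finset.sum_mul]
  rw [Finset.sum_comm]
  refine Finset.sum_congr rfl fun p hp => ?_
  have hF : ∀ k ∈ ({p.2, p.2 + Finsupp.single s(p.1, s) 1, p.2 - Finsupp.single s(p.1, s) 1} :
      Finset (Sym2 S →₀ ℕ)), k ∈ F := fun k hk => Finset.mem_biUnion.2 ⟨p, hp, hk⟩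
  have h := M.sum_stdForm_unfolding s p.1 p.2 F (hF _ (by simp)) (hF _ (by simp)) (hF _ (by simp))
  rw [show 2 * (v p * (M.unfoldCoeff p.2 * M.stdForm (M.simpleRoot s) (M.simpleRoot p.1))) =
    v p * (2 * M.stdForm (M.simpleRoot s) (M.simpleRoot p.1) * M.unfoldCoeff p.2) by ring, ← h,
    Finset.mul_sum]
  refine Finset.sum_congr rfl fun k _ => ?_
  ring

theorem simpleRefl_unfolding_integral (p : S × (Sym2 S →₀ ℕ)) {v : (S × (Sym2 S →₀ ℕ)) →₀ ℝ}
    (hv : ∀ q, ∃ n : ℤ, v q = n) (q : S × (Sym2 S →₀ ℕ)) :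
    ∃ n : ℤ, M.unfolding.simpleRefl p v q = n := by
  classical
  have hmem : ∀ x : ℝ, (∃ n : ℤ, x = n) ↔ x ∈ (Int.castRingHom ℝ).range := fun x =>
    ⟨fun ⟨n, h⟩ => ⟨n, h.symm⟩, fun ⟨n, h⟩ => ⟨n, h.symm⟩⟩
  by_cases hq : q = p
  swap
  · rw [simpleRefl_apply_of_ne hq]; exact hv q
  subst hq
  rw [simpleRefl_apply_same, hmem, dual_apply (M := M.unfolding), Finsupp.mul_sum]
  refine sub_mem ((hmem _).1 (hv q)) (sum_mem fun r _ => ?_)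
  beta_reduce
  rw [mul_left_comm, two_mul_stdForm_unfolding]
  refine mul_mem ((hmem _).1 (hv r)) ?_
  split_ifs
  · exact ⟨2, by simp⟩
  · exact ⟨-1, by simp⟩
  · exact zero_mem _

/-- Nodes over the same `s` are never linked, so their reflections commute and the product subtracts
all the terms at once. -/
theorem exists_unfolding_reflections (s : S) {v : (S × (Sym2 S →₀ ℕ)) →₀ ℝ}
    (hv : M.unfolding.IsRoot v) (hint : ∀ q, ∃ n : ℤ, v q = n) (F : Finset (Sym2 S →₀ ℕ)) :
    M.unfolding.IsRoot (v - ∑ k ∈ F, (2 * M.unfolding.stdForm (M.unfolding.simpleRoot (s, k)) v) •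
      M.unfolding.simpleRoot (s, k)) ∧
    ∀ q, ∃ n : ℤ, (v - ∑ k ∈ F, (2 * M.unfolding.stdForm (M.unfolding.simpleRoot (s, k)) v) •
      M.unfolding.simpleRoot (s, k)) q = n := by
  classical
  induction F using Finset.induction_on with
  | empty =>
    rw [Finset.sum_empty, sub_zero]
    exact ⟨hv, hint⟩
  | insert k F hk ih =>
    have hform : M.unfolding.stdForm (M.unfolding.simpleRoot (s, k))
        (v - ∑ k ∈ F, (2 * M.unfolding.stdForm (M.unfolding.simpleRoot (s, k)) v) •
          M.unfolding.simpleRoot (s, k)) =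
        M.unfolding.stdForm (M.unfolding.simpleRoot (s, k)) v := by
      rw [map_sub, map_sum, Finset.sum_eq_zero, sub_zero]
      intro l hl
      have hkl : k ≠ l := by rintro rfl; exact hk hl
      have h := M.two_mul_stdForm_unfolding (s, k) (s, l)
      rw [if_neg (by simpa using hkl), if_neg (M.not_unfoldAdj s k l)] at h
      rw [map_smul, smul_eq_mul, (mul_eq_zero.1 h).resolve_left two_ne_zero, mul_zero]
    have heq : v - ∑ k ∈ insert k F, (2 * M.unfolding.stdForm (M.unfolding.simpleRoot (s, k)) v) •
          M.unfolding.simpleRoot (s, k) = M.unfolding.simpleRefl (s, k)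
        (v - ∑ k ∈ F, (2 * M.unfolding.stdForm (M.unfolding.simpleRoot (s, k)) v) •
          M.unfolding.simpleRoot (s, k)) := by
      rw [simpleRefl_apply, hform, Finset.sum_insert hk]
      abel
    rw [heq]
    exact ⟨ih.1.simpleRefl _, M.simpleRefl_unfolding_integral _ ih.2⟩

variable {M}

/-- Under `foldMap`, the reflection in `s` is induced by a product of reflections over `s` upstairs,
so roots lift letter by letter. -/
theorem IsRoot.exists_unfolding {v : S →₀ ℝ} (hv : M.IsRoot v) :
    ∃ v', M.unfolding.IsRoot v' ∧ (∀ q, ∃ n : ℤ, v' q = n) ∧ M.foldMap v' = v := by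
  classical
  obtain ⟨w, t, rfl⟩ := hv
  induction w using M.toCoxeterSystem.simple_induction_left with
  | one =>
    refine ⟨M.unfolding.simpleRoot (t, 0), isRoot_simpleRoot _, fun q => ?_, ?_⟩
    · by_cases hq : (t, 0) = q
      · exact ⟨1, by simp [simpleRoot, hq]⟩
      · exact ⟨0, by simp [simpleRoot, hq]⟩
    · simp [foldMap_simpleRoot, unfoldCoeff_zero]
  | mul_simple_left w s ih =>
    obtain ⟨v', hv', hint, hfold⟩ := ih
    obtain ⟨F, hF⟩ := M.exists_finset_sum_stdForm s v'
    obtain ⟨h1, h2⟩ := M.exists_unfolding_reflections s hv' hint F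
    refine ⟨_, h1, h2, ?_⟩
    rw [toCoxeterSystem_simple, stdRep_simple_mul, ← hfold, simpleRefl_apply, ← hF, map_sub,
      map_sum, Finset.sum_smul]
    simp only [map_smul, foldMap_simpleRoot, smul_smul]

theorem foldMap_apply (v : (S × (Sym2 S →₀ ℕ)) →₀ ℝ) (x : S) :
    M.foldMap v x = ∑ p ∈ v.support, v p * (M.unfoldCoeff p.2 * M.simpleRoot p.1 x) := by
  simp [foldMap, Finsupp.linearCombination_apply, Finsupp.sum]

theorem foldMap_mem_gap {v : (S × (Sym2 S →₀ ℕ)) →₀ ℝ} (hint : ∀ q, ∃ n : ℤ, v q = n)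
    (hv : ∀ q, 0 ≤ v q) (x : S) :
    M.foldMap v x ∈ gapSemiring √2 one_le_sqrt_two sqrt_two_le_two := by
  classical
  rw [foldMap_apply]
  refine sum_mem fun p _ => mul_mem ?_ (mul_mem (M.unfoldCoeff_mem_gap _) ?_)
  · obtain ⟨n, hn⟩ := hint p
    have h0 : 0 ≤ n := by have := hv p; rw [hn] at this; exact_mod_cast this
    lift n to ℕ using h0
    rw [hn, Int.cast_natCast]
    exact natCast_mem _ _
  · rw [simpleRoot, Finsupp.single_apply]
    split_ifs
    exacts [one_mem _, zero_mem _]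

/-- The coefficients of a positive root are `0`, `1` or at least `√2`. -/
theorem IsPosRoot.coeff_mem_gap {v : S →₀ ℝ} (hv : M.IsPosRoot v) (x : S) :
    v x = 0 ∨ v x = 1 ∨ √2 ≤ v x := by
  obtain ⟨v', hv', hint, hfold⟩ := hv.1.exists_unfolding
  obtain h | h := hv'.nonneg_or_nonpos
  · have := foldMap_mem_gap (M := M) hint h x
    rwa [hfold] at this
  -- A nonpositive lift folds to a nonpositive vector, so the coefficient is zero.
  · left
    have h1 := foldMap_mem_gap (M := M) (v := -v')
      (fun q => by obtain ⟨n, hn⟩ := hint q; exact ⟨-n, by simp [hn]⟩)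
      (fun q => by simpa using h q) x
    rw [map_neg, hfold, Finsupp.neg_apply] at h1
    linarith [gapSemiring_nonneg h1, hv.nonneg x]

end

end CoxeterMatrix

namespace CoxeterMatrix

noncomputable section

variable {S : Type*} {M : CoxeterMatrix S}

/-! ### Link weights -/

variable (M) in
/-- The number `2 cos (π / m_{s,t})`. -/
def linkWeight (s t : S) : ℝ := 2 * Real.cos (Real.pi / (M s t : ℝ))

theorem linkWeight_comm (s t : S) : M.linkWeight s t = M.linkWeight t s := by
  rw [linkWeight, linkWeight, M.symmetric]

theorem linkWeight_eq_one {s t : S} (h : M s t = 3) : M.linkWeight s t = 1 := by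
  rw [linkWeight, h]; push_cast; rw [Real.cos_pi_div_three]; norm_num

theorem linkWeight_eq_zero {s t : S} (hst : s ≠ t) (h : ¬ M.coxeterGraph.Adj s t) :
    M.linkWeight s t = 0 := by
  have h2 : M s t = 2 := by
    by_contra h'
    exact h ⟨hst, h'⟩
  rw [linkWeight, h2]; push_cast; rw [Real.cos_pi_div_two, mul_zero]

theorem Adj.degree_cases {s t : S} (h : M.coxeterGraph.Adj s t) :
    M s t = 3 ∨ 4 ≤ M s t ∨ M s t = 0 := by
  have h1 := M.off_diagonal s t h.1
  have h2 := h.2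
  omega

theorem sqrt_two_le_linkWeight {s t : S} (h : M.coxeterGraph.Adj s t) (h3 : M s t ≠ 3) :
    √2 ≤ M.linkWeight s t :=
  sqrt_two_le_two_mul_cos ((Adj.degree_cases h).resolve_left h3)

theorem one_le_linkWeight {s t : S} (h : M.coxeterGraph.Adj s t) : 1 ≤ M.linkWeight s t := by
  by_cases h3 : M s t = 3
  · rw [linkWeight_eq_one h3]
  · exact one_le_sqrt_two.trans (sqrt_two_le_linkWeight h h3)

theorem linkWeight_nonneg {s t : S} (h : s ≠ t) : 0 ≤ M.linkWeight s t := by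
  by_cases ha : M.coxeterGraph.Adj s t
  · exact zero_le_one.trans (one_le_linkWeight ha)
  · rw [linkWeight_eq_zero h ha]

variable (M) in
open Classical in
/-- The sum of the coefficients of `v` at the nodes other than `s`, weighted by the links to `s`. -/
def linkSum (s : S) (v : S →₀ ℝ) : ℝ := ∑ t ∈ v.support.erase s, M.linkWeight s t * v t

theorem two_mul_stdForm_eq (s : S) (v : S →₀ ℝ) :
    2 * M.stdForm (M.simpleRoot s) v = 2 * v s - M.linkSum s v := by
  classical
  have h : ∀ t, 2 * (v t * M.stdForm (M.simpleRoot s) (M.simpleRoot t)) =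
      -(M.linkWeight s t * v t) := by
    intro t; rw [stdForm_simpleRoot, linkWeight]; ring
  rw [dual_apply (M := M), Finsupp.mul_sum, Finsupp.sum, linkSum]
  simp only [h]
  by_cases hs : s ∈ v.support
  · rw [← Finset.add_sum_erase _ _ hs, Finset.sum_neg_distrib, ← h s, stdForm_self]
    ring
  · rw [Finset.erase_eq_of_notMem hs, Finsupp.notMem_support_iff.1 hs, Finset.sum_neg_distrib]
    ring

theorem simpleRefl_eq_linkSum (s : S) (v : S →₀ ℝ) :
    M.simpleRefl s v s = M.linkSum s v - v s := by
  rw [simpleRefl_apply_same, two_mul_stdForm_eq]; ring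

theorem IsPosRoot.one_le {v : S →₀ ℝ} (hv : M.IsPosRoot v) {x : S} (hx : v x ≠ 0) : 1 ≤ v x := by
  rcases hv.coeff_mem_gap x with h | h | h
  · exact absurd h hx
  · exact h.ge
  · exact one_le_sqrt_two.trans h

theorem IsPosRoot.term_nonneg {v : S →₀ ℝ} (hv : M.IsPosRoot v) {s t : S} (h : t ≠ s) :
    0 ≤ M.linkWeight s t * v t := mul_nonneg (linkWeight_nonneg h.symm) (hv.nonneg t)

theorem IsPosRoot.le_linkSum {v : S →₀ ℝ} (hv : M.IsPosRoot v) {s t : S} (h : t ≠ s)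
    (ht : v t ≠ 0) : M.linkWeight s t * v t ≤ M.linkSum s v := by
  classical
  exact Finset.single_le_sum (f := fun t => M.linkWeight s t * v t)
    (fun i hi => hv.term_nonneg (Finset.ne_of_mem_erase hi))
    (Finset.mem_erase.2 ⟨h, Finsupp.mem_support_iff.2 ht⟩)

theorem IsPosRoot.add_le_linkSum {v : S →₀ ℝ} (hv : M.IsPosRoot v) {s t t' : S} (h : t ≠ s)
    (ht : v t ≠ 0) (h' : t' ≠ s) (ht' : v t' ≠ 0) (htt' : t ≠ t') :
    M.linkWeight s t * v t + M.linkWeight s t' * v t' ≤ M.linkSum s v := by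
  classical
  rw [← Finset.sum_pair (f := fun t => M.linkWeight s t * v t) htt']
  refine Finset.sum_le_sum_of_subset_of_nonneg ?_
    fun i hi _ => hv.term_nonneg (Finset.ne_of_mem_erase hi)
  intro x hx
  rw [Finset.mem_insert, Finset.mem_singleton] at hx
  rcases hx with rfl | rfl <;> simp [*]

theorem IsPosRoot.one_le_term {v : S →₀ ℝ} (hv : M.IsPosRoot v) {s t : S}
    (h : M.coxeterGraph.Adj s t) (ht : v t ≠ 0) : 1 ≤ M.linkWeight s t * v t :=
  one_le_mul_of_one_le_of_one_le (one_le_linkWeight h) (hv.one_le ht)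

/-- A node outside the support at which a minimal root can be reflected to another minimal root is
linked to exactly one node of the support. -/
theorem IsPosRoot.exists_unique_link {u : S →₀ ℝ} (hu : M.IsPosRoot u) {s : S}
    (hlo : 0 < M.linkSum s u) (hhi : M.linkSum s u < 2) :
    ∃ t, u t ≠ 0 ∧ M.coxeterGraph.Adj s t ∧ M.linkSum s u = M.linkWeight s t * u t ∧
      ∀ t', u t' ≠ 0 → M.coxeterGraph.Adj s t' → t' = t := by
  classical
  obtain ⟨t, ht, hpos⟩ := Finset.exists_ne_zero_of_sum_ne_zero hlo.ne'
  have hts := Finset.ne_of_mem_erase ht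
  have hut : u t ≠ 0 := Finsupp.mem_support_iff.1 (Finset.mem_of_mem_erase ht)
  have hadj : M.coxeterGraph.Adj s t := by
    by_contra h
    rw [linkWeight_eq_zero hts.symm h, zero_mul] at hpos
    exact hpos rfl
  have huniq : ∀ t', u t' ≠ 0 → M.coxeterGraph.Adj s t' → t' = t := by
    intro t' ht' hadj'
    by_contra hne
    have h1 := hu.add_le_linkSum hadj'.1.symm ht' hts hut hne
    have h2 := hu.one_le_term hadj hut
    have h3 := hu.one_le_term hadj' ht'
    linarith
  refine ⟨t, hut, hadj, ?_, huniq⟩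
  refine Finset.sum_eq_single_of_mem t ht fun t' ht' hne => ?_
  rw [linkWeight_eq_zero (Finset.ne_of_mem_erase ht').symm, zero_mul]
  exact fun h => hne (huniq t' (Finsupp.mem_support_iff.1 (Finset.mem_of_mem_erase ht')) h)

/-- The induction principle for minimal roots, in terms of link sums. -/
theorem IsMinimalRoot.link_induction {P : (S →₀ ℝ) → Prop} (simple : ∀ s, P (M.simpleRoot s))
    (step : ∀ u v s, M.IsMinimalRoot u → (∀ x, x ≠ s → v x = u x) →
      v s = M.linkSum s u - u s → 2 * u s < M.linkSum s u → M.linkSum s u < 2 * u s + 2 →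
      P u → P v)
    {v : S →₀ ℝ} (hv : M.IsMinimalRoot v) : P v := by
  refine hv.induction simple fun u s hu _ h1 h2 hPu => ?_
  have := two_mul_stdForm_eq (M := M) s u
  exact step u _ s hu (fun x hx => simpleRefl_apply_of_ne hx u) (simpleRefl_eq_linkSum s u)
    (by linarith) (by linarith) hPu

theorem simpleRoot_apply_ne_zero {s x : S} (h : M.simpleRoot s x ≠ 0) : x = s := by
  by_contra hne
  exact h (by simp [simpleRoot, Ne.symm hne])

/-! ### Inductions along the chain of minimal roots -/

/-- The links in the support of a minimal root have finite degree. -/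
theorem IsMinimalRoot.degree_ne_zero {v : S →₀ ℝ} (hv : M.IsMinimalRoot v) :
    ∀ x y, M.coxeterGraph.Adj x y → v x ≠ 0 → v y ≠ 0 → M x y ≠ 0 := by
  refine hv.link_induction (P := fun v => ∀ x y, M.coxeterGraph.Adj x y → v x ≠ 0 → v y ≠ 0 →
    M x y ≠ 0) ?_ ?_
  · intro s x y hxy hx hy
    exact absurd (simpleRoot_apply_ne_zero hx) (simpleRoot_apply_ne_zero hy ▸ hxy.1)
  · rintro u v s ⟨hu, -⟩ hne hs hlo hhi ih
    have key : ∀ y, M.coxeterGraph.Adj s y → v y ≠ 0 → M s y ≠ 0 := by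
      intro y hsy hy
      rw [hne y hsy.1.symm] at hy
      by_cases hus : u s = 0
      · intro h0
        have h1 := hu.le_linkSum hsy.1.symm hy
        have h2 : M.linkWeight s y = 2 := by simp [linkWeight, h0]
        have h3 := hu.one_le hy
        rw [h2] at h1
        rw [hus] at hhi
        linarith
      · exact ih s y hsy hus hy
    intro x y hxy hx hy
    by_cases hxs : x = s
    · subst hxs; exact key y hxy hy
    by_cases hys : y = s
    · subst hys; rw [M.symmetric]; exact key x hxy.symm hx
    · rw [hne x hxs] at hx
      rw [hne y hys] at hy
      exact ih x y hxy hx hy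

/-- If a minimal root has coefficient `1` at `x`, then each node linked to `x` contributes `0`,
`1` or at least `2` to the link sum at `x`. -/
theorem IsMinimalRoot.term_mem_gap {v : S →₀ ℝ} (hv : M.IsMinimalRoot v) :
    ∀ x y, M.coxeterGraph.Adj x y → v x = 1 →
      M.linkWeight x y * v y ∈ gapSemiring 2 one_le_two le_rfl := by
  refine hv.link_induction (P := fun v => ∀ x y, M.coxeterGraph.Adj x y → v x = 1 →
    M.linkWeight x y * v y ∈ gapSemiring 2 one_le_two le_rfl) ?_ ?_
  · intro s x y hxy hx
    have h1 := simpleRoot_apply_ne_zero (M := M) (s := s) (x := x) (by rw [hx]; exact one_ne_zero)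
    have h2 : M.simpleRoot s y = 0 := by
      by_contra h
      exact hxy.1 (h1.trans (simpleRoot_apply_ne_zero h).symm)
    rw [h2, mul_zero]
    exact zero_mem _
  · rintro u v s ⟨hu, -⟩ hne hs hlo hhi ih x y hxy hx
    by_cases hxs : x = s
    · subst hxs
      have hux : u x = 0 := by
        by_contra h
        have := hu.one_le h
        linarith
      rw [hne y hxy.1.symm]
      by_cases hy : u y = 0
      · rw [hy, mul_zero]; exact zero_mem _
      · have h1 := hu.one_le_term hxy hy
        have h2 := hu.le_linkSum hxy.1.symm hy
        exact Or.inr (Or.inl (by linarith))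
    rw [hne x hxs] at hx
    by_cases hys : y = s
    swap
    · rw [hne y hys]; exact ih x y hxy hx
    subst hys
    by_cases huy : u y = 0
    -- Here `y` is new and `x` is its only neighbour, so the contribution of `y` at `x` is the
    -- square of the link weight: `1`, or at least `√2 ^ 2 = 2`.
    · obtain ⟨t, -, -, hsum, huniq⟩ := hu.exists_unique_link (by linarith) (by linarith)
      have hxt := huniq x (by rw [hx]; exact one_ne_zero) hxy.symm
      subst hxt
      rw [hs, huy, hsum, hx, sub_zero, mul_one, linkWeight_comm y x]
      by_cases h3 : M x y = 3
      · rw [linkWeight_eq_one h3, mul_one]; exact one_mem _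
      · right; right
        have h1 := sqrt_two_le_linkWeight hxy h3
        have h2 := Real.mul_self_sqrt (zero_le_two (α := ℝ))
        nlinarith [Real.sqrt_nonneg 2]
    · have hw1 := one_le_linkWeight hxy
      have hu1 := hu.one_le huy
      rcases ih x y hxy hx with h | h | h
      · have := hu.one_le_term hxy huy
        linarith
      · have hw : M.linkWeight x y = 1 := by nlinarith
        have huy1 : u y = 1 := by rw [hw, one_mul] at h; exact h
        classical
        have hmem : x ∈ u.support.erase y :=
          Finset.mem_erase.2 ⟨hxs, Finsupp.mem_support_iff.2 (by rw [hx]; exact one_ne_zero)⟩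
        -- The contribution of `x` cancels the old coefficient `1` of `y`. The new one is a sum of
        -- contributions at `y`, which the induction hypothesis covers because `u y = 1`.
        have hvy : v y = ∑ z ∈ (u.support.erase y).erase x, M.linkWeight y z * u z := by
          rw [hs, linkSum, ← Finset.add_sum_erase _ _ hmem, huy1, hx, linkWeight_comm y x, hw]
          ring
        rw [hw, one_mul, hvy]
        refine sum_mem fun z hz => ?_
        have hzy := Finset.ne_of_mem_erase (Finset.mem_of_mem_erase hz)
        by_cases hyz : M.coxeterGraph.Adj y z
        · exact ih y z hyz huy1
        · rw [linkWeight_eq_zero hzy.symm hyz, zero_mul]; exact zero_mem _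
      · right; right
        have : u y ≤ v y := by linarith
        nlinarith

/-- The support only grows along the chain, so every link weight used in a step belongs to a link in
the final support. -/
theorem IsMinimalRoot.coeff_mem {v : S →₀ ℝ} (hv : M.IsMinimalRoot v) (A : Subring ℝ) :
    (∀ x y, M.coxeterGraph.Adj x y → v x ≠ 0 → v y ≠ 0 → M.linkWeight x y ∈ A) →
      ∀ x, v x ∈ A := by
  refine hv.link_induction (P := fun v =>
    (∀ x y, M.coxeterGraph.Adj x y → v x ≠ 0 → v y ≠ 0 → M.linkWeight x y ∈ A) →
      ∀ x, v x ∈ A) ?_ ?_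
  · classical
    intro s _ x
    rw [simpleRoot, Finsupp.single_apply]
    split_ifs
    exacts [one_mem _, zero_mem _]
  · rintro u v s ⟨hu, -⟩ hne hs hlo hhi ih hA x
    have hvs : v s ≠ 0 := by have := hu.nonneg s; linarith
    have hsupp : ∀ x, u x ≠ 0 → v x ≠ 0 := by
      intro x hx
      by_cases hxs : x = s
      · rwa [hxs]
      · rwa [hne x hxs]
    have hu' := ih fun x y hxy hx hy => hA x y hxy (hsupp x hx) (hsupp y hy)
    by_cases hxs : x = s
    swap
    · rw [hne x hxs]; exact hu' x
    subst hxs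
    rw [hs, linkSum]
    refine sub_mem (sum_mem fun z hz => mul_mem ?_ (hu' z)) (hu' x)
    classical
    have hzx := Finset.ne_of_mem_erase hz
    by_cases hxz : M.coxeterGraph.Adj x z
    · exact hA x z hxz hvs (hsupp z (Finsupp.mem_support_iff.1 (Finset.mem_of_mem_erase hz)))
    · rw [linkWeight_eq_zero hzx.symm hxz]; exact zero_mem _

/-! ### Paths in the support -/

variable (M) in
/-- A path `p 0, …, p n` in the support of `v` that does not turn back. -/
structure IsSupportPath (v : S →₀ ℝ) (p : ℕ → S) (n : ℕ) : Prop where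
  adj : ∀ i < n, M.coxeterGraph.Adj (p i) (p (i + 1))
  ne : ∀ i, i + 2 ≤ n → p i ≠ p (i + 2)
  supp : ∀ i ≤ n, v (p i) ≠ 0

theorem IsSupportPath.mono {v u : S →₀ ℝ} {p : ℕ → S} {n : ℕ} (h : M.IsSupportPath v p n)
    (hu : ∀ i ≤ n, u (p i) ≠ 0) : M.IsSupportPath u p n := ⟨h.adj, h.ne, hu⟩

/-- On a path in the support of a minimal root whose two end links are multiple, some inner node
has coefficient `1`. -/
theorem IsMinimalRoot.exists_unit {v : S →₀ ℝ} (hv : M.IsMinimalRoot v) :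
    ∀ (p : ℕ → S) (n : ℕ), M.IsSupportPath v p (n + 2) → M (p 0) (p 1) ≠ 3 →
      M (p (n + 1)) (p (n + 2)) ≠ 3 → ∃ i, 0 < i ∧ i < n + 2 ∧ v (p i) = 1 := by
  refine hv.link_induction (P := fun v => ∀ (p : ℕ → S) (n : ℕ), M.IsSupportPath v p (n + 2) →
    M (p 0) (p 1) ≠ 3 → M (p (n + 1)) (p (n + 2)) ≠ 3 →
    ∃ i, 0 < i ∧ i < n + 2 ∧ v (p i) = 1) ?_ ?_
  · intro s p n hp _ _
    exact absurd ((simpleRoot_apply_ne_zero (hp.supp 0 (by omega))).trans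
      (simpleRoot_apply_ne_zero (hp.supp 1 (by omega))).symm) (hp.adj 0 (by omega)).1
  intro u v s hmin hne hs hlo hhi ih p n hp h3 h3'
  have hu := hmin.1
  by_cases hus : u s = 0
  · obtain ⟨t, -, -, hsum, huniq⟩ := hu.exists_unique_link (s := s) (by linarith) (by linarith)
    -- Now `L < 2` while the weight is at least `√2`, so the neighbour's coefficient is below `√2`,
    -- and the gap leaves only `1`.
    have hunit : ∀ y, M.coxeterGraph.Adj s y → M s y ≠ 3 → v y ≠ 0 → v y = 1 := by
      intro y hsy hy3 hy
      rw [hne y hsy.1.symm] at hy ⊢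
      have h1 := hu.le_linkSum hsy.1.symm hy
      have h2 := sqrt_two_le_linkWeight hsy hy3
      refine ((hu.coeff_mem_gap y).resolve_left hy).resolve_right fun h => ?_
      have h4 := Real.mul_self_sqrt (zero_le_two (α := ℝ))
      nlinarith [Real.sqrt_nonneg 2]
    by_cases hex : ∃ i ≤ n + 2, p i = s
    · obtain ⟨i, hi, his⟩ := hex
      obtain rfl | hi0 := Nat.eq_zero_or_pos i
      · refine ⟨1, by omega, by omega, hunit _ ?_ ?_ (hp.supp 1 (by omega))⟩
        · rw [← his]; exact hp.adj 0 (by omega)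
        · rw [← his]; exact h3
      obtain rfl | hin := eq_or_lt_of_le hi
      · refine ⟨n + 1, by omega, by omega, hunit _ ?_ ?_ (hp.supp _ (by omega))⟩
        · rw [← his]; exact (hp.adj (n + 1) (by omega)).symm
        · rw [← his, M.symmetric]; exact h3'
      -- As an inner node of the path, `s` would have two distinct neighbours in the old support.
      obtain ⟨j, rfl⟩ : ∃ j, i = j + 1 := ⟨i - 1, by omega⟩
      have ha : M.coxeterGraph.Adj s (p j) := by rw [← his]; exact (hp.adj j (by omega)).symm
      have hb : M.coxeterGraph.Adj s (p (j + 2)) := by rw [← his]; exact hp.adj (j + 1) (by omega)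
      have ha' := hp.supp j (by omega)
      have hb' := hp.supp (j + 2) (by omega)
      rw [hne _ ha.1.symm] at ha'
      rw [hne _ hb.1.symm] at hb'
      exact absurd ((huniq _ ha' ha).trans (huniq _ hb' hb).symm) (hp.ne j (by omega))
    · push Not at hex
      obtain ⟨i, h0, hi, h1⟩ := ih p n
        (hp.mono fun i hi => by rw [← hne _ (hex i hi)]; exact hp.supp i hi) h3 h3'
      exact ⟨i, h0, hi, by rw [hne _ (hex i hi.le), h1]⟩
  · obtain ⟨i, h0, hi, h1⟩ := ih p n (hp.mono fun i hi => by
      by_cases h : p i = s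
      · rwa [h]
      · rw [← hne _ h]; exact hp.supp i hi) h3 h3'
    by_contra! hcon
    have his : p i = s := by
      by_contra h
      exact hcon i h0 hi (by rw [hne _ h, h1])
    have hu1 : u s = 1 := by rw [← his, h1]
    -- The unit node found before is `s` itself, so `L < 4`. A path neighbour contributing `1` would
    -- have coefficient `1` across a simple link, hence be an inner unit node that survives. So both
    -- contribute at least `2`, a contradiction.
    have key : ∀ j ≤ n + 2, M.coxeterGraph.Adj s (p j) → (j = 0 ∨ j = n + 2 → M s (p j) ≠ 3) →
        u (p j) ≠ 0 ∧ 2 ≤ M.linkWeight s (p j) * u (p j) := by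
      intro j hj hadj hend
      have hnz : u (p j) ≠ 0 := by rw [← hne _ hadj.1.symm]; exact hp.supp j hj
      refine ⟨hnz, ?_⟩
      have hw := one_le_linkWeight hadj
      have hx := hu.one_le hnz
      rcases hmin.term_mem_gap s (p j) hadj hu1 with h | h | h
      · nlinarith
      · exfalso
        by_cases hj' : j = 0 ∨ j = n + 2
        · have h4 := sqrt_two_le_linkWeight hadj (hend hj')
          have h5 : (1 : ℝ) < √2 := Real.one_lt_sqrt_two
          nlinarith
        · exact hcon j (by omega) (by omega) (by rw [hne _ hadj.1.symm]; nlinarith)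
      · exact h
    obtain ⟨j, rfl⟩ : ∃ j, i = j + 1 := ⟨i - 1, by omega⟩
    have ha : M.coxeterGraph.Adj s (p j) := by rw [← his]; exact (hp.adj j (by omega)).symm
    have hb : M.coxeterGraph.Adj s (p (j + 2)) := by rw [← his]; exact hp.adj (j + 1) (by omega)
    obtain ⟨ha1, ha2⟩ := key j (by omega) ha (by
      rintro (rfl | h)
      · rw [← his, M.symmetric]; exact h3
      · omega)
    obtain ⟨hb1, hb2⟩ := key (j + 2) (by omega) hb (by
      rintro (h | h)
      · omega
      · obtain rfl : j = n := by omega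
        rw [← his]; exact h3')
    have := hu.add_le_linkSum ha.1.symm ha1 hb.1.symm hb1 (hp.ne j (by omega))
    rw [hu1] at hhi
    linarith

variable (M) in
/-- The links within the support of `v`, as a relation. -/
def SupportAdj (v : S →₀ ℝ) (x y : S) : Prop := M.coxeterGraph.Adj x y ∧ v x ≠ 0 ∧ v y ≠ 0

/-- The support of a minimal root is connected. -/
theorem IsMinimalRoot.connected {v : S →₀ ℝ} (hv : M.IsMinimalRoot v) {x y : S} (hx : v x ≠ 0)
    (hy : v y ≠ 0) : Relation.ReflTransGen (M.SupportAdj v) x y := by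
  have hroot : ∃ r, ∀ x, v x ≠ 0 → Relation.ReflTransGen (M.SupportAdj v) r x := by
    refine hv.link_induction (P := fun v => ∃ r, ∀ x, v x ≠ 0 →
      Relation.ReflTransGen (M.SupportAdj v) r x) ?_ ?_
    · intro s
      refine ⟨s, fun x hx => ?_⟩
      rw [simpleRoot_apply_ne_zero hx]
    · rintro u v s ⟨hu, -⟩ hne hs hlo hhi ⟨r, hr⟩
      have hvs : v s ≠ 0 := by have := hu.nonneg s; linarith
      have hsupp : ∀ x, u x ≠ 0 → v x ≠ 0 := by
        intro x hx
        by_cases hxs : x = s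
        · rwa [hxs]
        · rwa [hne x hxs]
      have hr' : ∀ x, u x ≠ 0 → Relation.ReflTransGen (M.SupportAdj v) r x := fun x hx =>
        Relation.ReflTransGen.mono (fun a b h => ⟨h.1, hsupp a h.2.1, hsupp b h.2.2⟩) _ _ (hr x hx)
      refine ⟨r, fun x hx => ?_⟩
      by_cases hxs : x = s
      · subst hxs
        by_cases hux : u x = 0
        · obtain ⟨t, ht, hadj, -⟩ := hu.exists_unique_link (s := x) (by linarith) (by linarith)
          exact (hr' t ht).tail ⟨hadj.symm, hsupp t ht, hx⟩
        · exact hr' x hux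
      · rw [hne x hxs] at hx
        exact hr' x hx
  obtain ⟨r, hr⟩ := hroot
  have hsymm : Std.Symm (M.SupportAdj v) := ⟨fun a b h => ⟨h.1.symm, h.2.2, h.2.1⟩⟩
  exact (Relation.ReflTransGen.stdSymm.symm _ _ (hr x hx)).trans (hr y hy)

theorem IsSupportPath.append {v : S →₀ ℝ} {p : ℕ → S} {n : ℕ} (h : M.IsSupportPath v p n)
    {z : S} (hz : M.coxeterGraph.Adj (p n) z) (hvz : v z ≠ 0)
    (hne : ∀ i, i + 1 = n → p i ≠ z) :
    M.IsSupportPath v (Function.update p (n + 1) z) (n + 1) := by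
  have e : ∀ i ≤ n, Function.update p (n + 1) z i = p i := fun i hi =>
    Function.update_of_ne (by omega) _ _
  refine ⟨fun i hi => ?_, fun i hi => ?_, fun i hi => ?_⟩
  · rw [e i (by omega)]
    obtain rfl | hi' := eq_or_ne i n
    · rwa [Function.update_self]
    · rw [e (i + 1) (by omega)]; exact h.adj i (by omega)
  · rw [e i (by omega)]
    obtain hi' | hi' := eq_or_ne (i + 1) n
    · rw [show i + 2 = n + 1 by omega, Function.update_self]
      exact hne i hi'
    · rw [e (i + 2) (by omega)]; exact h.ne i (by omega)
  · obtain rfl | hi' := eq_or_ne i (n + 1)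
    · rwa [Function.update_self]
    · rw [e i (by omega)]; exact h.supp i (by omega)

/-- Starting with a given link, in one of its two directions, any node of the support can be
reached without turning back. -/
theorem IsMinimalRoot.exists_supportPath {v : S →₀ ℝ} (hv : M.IsMinimalRoot v) {a b : S}
    (hab : M.coxeterGraph.Adj a b) (ha : v a ≠ 0) (hb : v b ≠ 0) {z : S} (hz : v z ≠ 0) :
    ∃ (p : ℕ → S) (n : ℕ), M.IsSupportPath v p (n + 1) ∧ s(p 0, p 1) = s(a, b) ∧
      p (n + 1) = z := by
  have hlink : ∀ c d, M.coxeterGraph.Adj c d → v c ≠ 0 → v d ≠ 0 →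
      M.IsSupportPath v (fun i => if i = 0 then c else d) 1 := by
    intro c d hcd hc hd
    refine ⟨fun i hi => ?_, fun i hi => by omega, fun i hi => ?_⟩
    · obtain rfl : i = 0 := by omega
      exact hcd
    · split_ifs <;> assumption
  induction hv.connected ha hz with
  | refl => exact ⟨_, 0, hlink b a hab.symm hb ha, Sym2.eq_swap, rfl⟩
  | @tail y z _ hyz ih =>
    obtain ⟨p, n, hp, h01, hpn⟩ := ih hyz.2.1
    -- Stepping to `z` would turn back, so the last node is dropped instead; if the path is just the
    -- initial link, the link is reversed.
    by_cases hzn : p n = z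
    · obtain rfl | hn := Nat.eq_zero_or_pos n
      · refine ⟨_, 0, hlink y z hyz.1 hyz.2.1 hyz.2.2, ?_, rfl⟩
        rw [← h01, Sym2.eq_swap, ← hzn, ← hpn]
        rfl
      · obtain ⟨k, rfl⟩ : ∃ k, n = k + 1 := ⟨n - 1, by omega⟩
        exact ⟨p, k, ⟨fun i hi => hp.adj i (by omega), fun i hi => hp.ne i (by omega),
          fun i hi => hp.supp i (by omega)⟩, h01, hzn⟩
    · refine ⟨_, n + 1, hp.append (z := z) (hpn ▸ hyz.1) hyz.2.2 ?_, ?_, Function.update_self ..⟩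
      · intro i hi
        obtain rfl : i = n := by omega
        exact hzn
      · rw [Function.update_of_ne (by omega), Function.update_of_ne (by omega), h01]

/-- A path from one multiple link to an end of the other is made to finish with that other link; an
inner unit node on it cannot be a boundary node. -/
theorem IsIndecomposable.multiple_link_unique {v : S →₀ ℝ} (hv : M.IsIndecomposable v)
    {a b c d : S} (hab : M.coxeterGraph.Adj a b) (ha : v a ≠ 0) (hb : v b ≠ 0) (hab3 : M a b ≠ 3)
    (hcd : M.coxeterGraph.Adj c d) (hc : v c ≠ 0) (hd : v d ≠ 0) (hcd3 : M c d ≠ 3) :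
    s(a, b) = s(c, d) := by
  by_contra hne
  have hpath : ∃ (p : ℕ → S) (n : ℕ), M.IsSupportPath v p (n + 2) ∧ M (p 0) (p 1) ≠ 3 ∧
      M (p (n + 1)) (p (n + 2)) ≠ 3 := by
    obtain ⟨p, n, hp, h01, hpn⟩ := hv.1.exists_supportPath hab ha hb hc
    have hdeg : M (p 0) (p 1) ≠ 3 := by
      have h : M.degree s(p 0, p 1) = M.degree s(a, b) := by rw [h01]
      change M (p 0) (p 1) = M a b at h
      rwa [h]
    -- Having reached `c` from `d`, the path already ends with the second link; otherwise `d` is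
    -- appended.
    by_cases hdn : p n = d
    · obtain rfl | hn := Nat.eq_zero_or_pos n
      · refine absurd ?_ hne
        rw [← h01, ← hpn, ← hdn, Sym2.eq_swap]
      · obtain ⟨k, rfl⟩ : ∃ k, n = k + 1 := ⟨n - 1, by omega⟩
        refine ⟨p, k, hp, hdeg, ?_⟩
        rw [hdn, hpn, M.symmetric]
        exact hcd3
    · refine ⟨_, n, hp.append (z := d) (hpn ▸ hcd) hd ?_, ?_, ?_⟩
      · intro i hi
        obtain rfl : i = n := by omega
        exact hdn
      · rwa [Function.update_of_ne (by omega), Function.update_of_ne (by omega)]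
      · rwa [Function.update_of_ne (by omega), Function.update_self, hpn]
  obtain ⟨p, n, hp, h3, h3'⟩ := hpath
  obtain ⟨i, h0, hi, h1⟩ := hv.1.exists_unit p n hp h3 h3'
  obtain ⟨j, rfl⟩ : ∃ j, i = j + 1 := ⟨i - 1, by omega⟩
  have hbd : p (j + 1) ∈ M.boundary (v.support : Set S) := hv.2 h1
  refine hp.ne j (by omega) (hbd.2 ⟨?_, (hp.adj j (by omega)).symm⟩
    ⟨?_, hp.adj (j + 1) (by omega)⟩)
  · simpa using hp.supp j (by omega)
  · simpa using hp.supp (j + 2) (by omega)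

end

end CoxeterMatrix

theorem mainTheorem8 {S : Type*} (M : CoxeterMatrix S) (v : S →₀ ℝ)
    (hv : M.IsIndecomposable v) :
    (M.multipleLinksIn (v.support : Set S)).encard ≤ 1 ∧
    ∃ m : ℕ, 3 ≤ m ∧
      (m = 3 ∨ ∃ e ∈ M.linksIn (v.support : Set S), M.degree e = m) ∧
      (∀ e ∈ M.linksIn (v.support : Set S), M.degree e = 3 ∨ M.degree e = m) ∧
      ∀ s : S, v s ∈ Algebra.adjoin ℤ ({2 * Real.cos (Real.pi / (m : ℝ))} : Set ℝ) := by
  have hlink : ∀ a b, s(a, b) ∈ M.linksIn (v.support : Set S) ↔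
      M.coxeterGraph.Adj a b ∧ v a ≠ 0 ∧ v b ≠ 0 := by
    intro a b
    simp [CoxeterMatrix.linksIn]
  have hdeg : ∀ a b, M.degree s(a, b) = M a b := fun _ _ => rfl
  have huniq : ∀ e ∈ M.linksIn (v.support : Set S), M.degree e ≠ 3 →
      ∀ e' ∈ M.linksIn (v.support : Set S), M.degree e' ≠ 3 → e = e' := by
    intro e
    induction e using Sym2.ind with
    | _ a b =>
    intro he h3 e'
    induction e' using Sym2.ind with
    | _ c d =>
    intro he' h3'
    rw [hlink] at he he'
    exact hv.multiple_link_unique he.1 he.2.1 he.2.2 h3 he'.1 he'.2.1 he'.2.2 h3'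
  have hcoeff : ∀ m : ℕ, (∀ e ∈ M.linksIn (v.support : Set S), M.degree e = 3 ∨ M.degree e = m) →
      ∀ s : S, v s ∈ Algebra.adjoin ℤ ({2 * Real.cos (Real.pi / (m : ℝ))} : Set ℝ) := by
    intro m hm s
    refine hv.1.coeff_mem
      (Algebra.adjoin ℤ ({2 * Real.cos (Real.pi / (m : ℝ))} : Set ℝ)).toSubring ?_ s
    intro x y hxy hx hy
    rw [Subalgebra.mem_toSubring]
    obtain h | h := hm _ ((hlink x y).2 ⟨hxy, hx, hy⟩)
    · rw [CoxeterMatrix.linkWeight_eq_one h]; exact one_mem _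
    · rw [CoxeterMatrix.linkWeight, ← hdeg, h]; exact Algebra.self_mem_adjoin_singleton ℤ _
  refine ⟨Set.encard_le_one_iff.2 fun e e' he he' =>
    huniq e he.1 (by have := he.2; omega) e' he'.1 (by have := he'.2; omega), ?_⟩
  -- Take for `m` the degree of the only multiple link, finite by minimality, or `3` if there is
  -- none.
  by_cases hex : ∃ e ∈ M.linksIn (v.support : Set S), M.degree e ≠ 3
  · obtain ⟨e, he, h3⟩ := hex
    have h3le : 3 ≤ M.degree e := by
      induction e using Sym2.ind with
      | _ a b =>
      obtain ⟨hab, ha, hb⟩ := (hlink a b).1 he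
      have h0 := hv.1.degree_ne_zero a b hab ha hb
      have := CoxeterMatrix.Adj.degree_cases hab
      rw [hdeg]
      omega
    have hall : ∀ e' ∈ M.linksIn (v.support : Set S),
        M.degree e' = 3 ∨ M.degree e' = M.degree e := by
      intro e' he'
      by_cases h : M.degree e' = 3
      · exact Or.inl h
      · exact Or.inr (by rw [huniq e he h3 e' he' h])
    exact ⟨M.degree e, h3le, Or.inr ⟨e, he, rfl⟩, hall, hcoeff _ hall⟩
  · push Not at hex
    have hall : ∀ e ∈ M.linksIn (v.support : Set S), M.degree e = 3 ∨ M.degree e = 3 :=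
      fun e he => Or.inl (hex e he)
    exact ⟨3, le_rfl, Or.inl rfl, hall, hcoeff 3 hall⟩
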